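/- Let $\mathrm{Frm}$ be the category of frames. For a frame $L$ let $\mathcal{C}L$ be the frame of congruences on $L$ (equivalence relations on $L$ that are subframes of $L\times L$), ordered by inclusion. For $a\in L$ put $\nabla_a=\{(x,y)\mid x\vee a=y\vee a\}$ and $\Delta_a=\{(x,y)\mid x\wedge a=y\wedge a\}$. A frame homomorphism $f\colon L\to M$ induces a frame homomorphism $\mathcal{C}f\colon\mathcal{C}L\to\mathcal{C}M$, sending $C$ to the congruence generated by $(f\times f)(C)$; its right adjoint $(\mathcal{C}f)_*$ takes preimages under $f\times f$. This makes $\mathcal{C}$ a functor $\mathrm{Frm}\to\mathrm{Frm}$; put $\mathcal{C}^2=\mathcal{C}\circ\mathcal{C}$. A biframe is a triple $\mathcal{M}=(\mathcal{M}_0,\mathcal{M}_1,\mathcal{M}_2)$ of a frame $\mathcal{M}_0$ and two subframes $\mathcal{M}_1,\mathcal{M}_2$ that together generate $\mathcal{M}_0$; biframe homomorphisms are frame homomorphisms of the total parts $\mathcal{M}_0$ that preserve the parts $\mathcal{M}_1$ and $\mathcal{M}_2$. $\mathcal{M}$ is strictly zero-dimensional if every $a\in\mathcal{M}_1$ has a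 complement in $\mathcal{M}_0$ which lies in $\mathcal{M}_2$, and these complements generate $\mathcal{M}_2$. Let $\mathrm{Str0DBiFrm}$ be the category of strictly zero-dimensional biframes and biframe homomorphisms, and let $P\colon\mathrm{Str0DBiFrm}\to\mathrm{Frm}$, $\mathcal{M}\mapsto\mathcal{M}_1$, be the first part functor. We regard $\mathcal{C}L$ as a biframe with first part $\{\nabla_a\mid a\in L\}$ and second part the subframe generated by $\{\Delta_a\mid a\in L\}$; for $C\in\mathcal{C}^2L$ the quotient $\mathcal{C}L/C$ is a biframe whose parts are the images of the parts of $\mathcal{C}L$, and it is strictly zero-dimensional. For $\mathcal{M}$ in $\mathrm{Str0DBiFrm}$ let $\chi_{\mathcal{M}}\colon\mathcal{C}\mathcal{M}_1\to\mathcal{M}$ be the unique biframe homomorphism with $\chi_{\mathcal{M}}(\nabla_a)=a$ for $a\in\mathcal{M}_1$, and let $\ker\chi_{\mathcal{M}}\in\mathcal{C}^2\mathcal{M}_1$ be its kernel congruence. Let ${\int}\mathcal{C}^2$ be the Grothendieck construction of $\mathrm{Frm}\xrightarrow{\mathcal{C}^2}\mathrm{Frm}\hookrightarrow\mathrm{Cat}$: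 its objects are pairs $(L,C)$ with $L$ a frame and $C\in\mathcal{C}^2L$, and its morphisms $(L,C)\to(L',C')$ are the frame homomorphisms $f\colon L\to L'$ with $\mathcal{C}^2f(C)\le C'$. Let $F\colon{\int}\mathcal{C}^2\to\mathrm{Frm}$ be the projection $(L,C)\mapsto L$. 1. The assignment $J\colon\mathcal{M}\mapsto(\mathcal{M}_1,\ker\chi_{\mathcal{M}})$ defines a functor $J\colon\mathrm{Str0DBiFrm}\to{\int}\mathcal{C}^2$ which is full and faithful and has a left adjoint. Its essential image consists of the pairs $(L,C)$ with $C\le\mathfrak{D}_{\mathcal{C}L}$, where $\mathfrak{D}_{\mathcal{C}L}$ is the largest dense congruence on $\mathcal{C}L$ (a congruence is dense if only $0$ is congruent to $0$). The maps $\chi_{\mathcal{M}}$ induce a natural isomorphism $\mathcal{C}\mathcal{M}_1/\ker\chi_{\mathcal{M}}\cong\mathcal{M}$. 2. $P=F\circ J$, and $F$ is topological: every (possibly large) structured source $(X\to FA_i)_{i}$ has a unique $F$-initial lift. 3. Consequently $P$ is solid, that is, $P$ is faithful and every (possibly large) structured sink $(PA_i\to X)_{i}$ has a semifinal arrow. Moreover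 $\mathrm{Str0DBiFrm}$ is complete and cocomplete. 4. Let $D\colon\mathbb{I}\to\mathrm{Str0DBiFrm}$ be a diagram; put $L_X=PDX$ and $C_X=\ker\chi_{DX}$, so that $DX\cong\mathcal{C}L_X/C_X$. If $(\alpha_X\colon L_X\to L)_{X\in\mathbb{I}}$ is a colimit of $PD$ in $\mathrm{Frm}$, then the colimit of $D$ is $\mathcal{C}L/\bigvee_X\mathcal{C}^2\alpha_X(C_X)$ together with the morphisms obtained by lifting each $\mathcal{C}\alpha_X$ to a map between the quotients. 5. With $D$, $L_X$, $C_X$ as in 4, if $(\beta_X\colon L\to L_X)_{X\in\mathbb{I}}$ is a limit of $PD$ in $\mathrm{Frm}$, then the limit of $D$ is $\mathcal{C}L/\bigwedge_X(\mathcal{C}^2\beta_X)_*(C_X)$ together with the morphisms obtained by lifting each $\mathcal{C}\beta_X$ to a map between the quotients. -/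

import Mathlib

open CategoryTheory Order

universe u w w'

/-- A subframe: a subset closed under finite meets and arbitrary joins. -/
structure IsSubframe {L : Type u} [Frame L] (S : Set L) : Prop where
  top_mem : ⊤ ∈ S
  inf_mem : ∀ a ∈ S, ∀ b ∈ S, a ⊓ b ∈ S
  sSup_mem : ∀ T ⊆ S, sSup T ∈ S

namespace IsSubframe

variable {L : Type u} {M : Type u} [Frame L] [Frame M]

theorem iSup_mem {S : Set L} (hS : IsSubframe S) {ι : Sort*} (f : ι → L) (hf : ∀ i, f i ∈ S) :
    ⨆ i, f i ∈ S :=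
  hS.sSup_mem _ (by rintro _ ⟨i, rfl⟩; exact hf i)

theorem preimage {S : Set M} (hS : IsSubframe S) (f : FrameHom L M) : IsSubframe (f ⁻¹' S) where
  top_mem := by simpa using hS.top_mem
  inf_mem a ha b hb := by simpa using hS.inf_mem _ ha _ hb
  sSup_mem T hT := by
    simp only [Set.mem_preimage, map_sSup]
    exact hS.sSup_mem _ (by rintro _ ⟨a, ha, rfl⟩; exact hT ha)

theorem image {S : Set L} (hS : IsSubframe S) (f : FrameHom L M) : IsSubframe (f '' S) where
  top_mem := ⟨⊤, hS.top_mem, map_top f⟩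
  inf_mem := by
    rintro _ ⟨a, ha, rfl⟩ _ ⟨b, hb, rfl⟩
    exact ⟨a ⊓ b, hS.inf_mem a ha b hb, map_inf f a b⟩
  sSup_mem T hT := by
    refine ⟨sSup (S ∩ f ⁻¹' T), hS.sSup_mem _ Set.inter_subset_left, ?_⟩
    rw [map_sSup, Set.image_inter_preimage, Set.inter_eq_right.2 hT]

theorem univ : IsSubframe (Set.univ : Set L) :=
  ⟨trivial, fun _ _ _ _ => trivial, fun _ _ => trivial⟩

/-- Arbitrary joins in a subframe are computed in the ambient frame. -/
@[reducible] def supSet {S : Set L} (hS : IsSubframe S) : SupSet S where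
  sSup T := ⟨sSup (Subtype.val '' T), hS.sSup_mem _ (by rintro _ ⟨a, _, rfl⟩; exact a.2)⟩

theorem isLUB {S : Set L} (hS : IsSubframe S) (T : Set S) : IsLUB T (hS.supSet.sSup T) :=
  ⟨fun a ha => le_sSup (α := L) ⟨a, ha, rfl⟩,
    fun b hb => sSup_le (α := L) (by rintro _ ⟨a, ha, rfl⟩; exact hb ha)⟩

/-- A subframe, with the induced order, is a complete lattice (finite meets and arbitrary joins
are those of the ambient frame). -/
@[reducible] def completeLattice {S : Set L} (hS : IsSubframe S) : CompleteLattice S :=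
  { @completeLatticeOfSup S _ hS.supSet hS.isLUB with
    inf := fun a b => ⟨a ⊓ b, hS.inf_mem _ a.2 _ b.2⟩
    inf_le_left := fun _ _ => inf_le_left (α := L)
    inf_le_right := fun _ _ => inf_le_right (α := L)
    le_inf := fun _ _ _ => le_inf (α := L)
    top := ⟨⊤, hS.top_mem⟩
    le_top := fun _ => le_top (α := L) }

/-- A subframe, with the induced order, is a frame. -/
@[reducible] def frame {S : Set L} (hS : IsSubframe S) : Frame S :=
  @Frame.ofMinimalAxioms S hS.completeLattice
    (@Frame.MinimalAxioms.mk S hS.completeLattice (by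
      let := hS.completeLattice
      intro a s
      have key : ∀ x : S, (∀ b ∈ s, a ⊓ b ≤ x) → a ⊓ sSup s ≤ x := by
        intro x hx
        change (a : L) ⊓ sSup (Subtype.val '' s) ≤ x
        rw [inf_sSup_eq]
        refine iSup₂_le ?_
        rintro _ ⟨b, hb, rfl⟩
        exact hx b hb
      exact key _ fun b hb => le_iSup₂_of_le b hb le_rfl))

end IsSubframe

/-- The subframe generated by a subset. -/
def subframeClosure {L : Type u} [Frame L] (T : Set L) : Set L :=
  ⋂₀ {S | IsSubframe S ∧ T ⊆ S}

section

variable {L : Type u} {M : Type u} [Frame L] [Frame M]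

theorem subframeClosure_isSubframe (T : Set L) : IsSubframe (subframeClosure T) where
  top_mem := fun _ hS => hS.1.top_mem
  inf_mem := fun a ha b hb S hS => hS.1.inf_mem a (ha S hS) b (hb S hS)
  sSup_mem := fun _ hU S hS => hS.1.sSup_mem _ fun _ ha => hU ha S hS

theorem subset_subframeClosure (T : Set L) : T ⊆ subframeClosure T := fun _ ha _ hS => hS.2 ha

theorem subframeClosure_subset {T S : Set L} (hS : IsSubframe S) (h : T ⊆ S) :
    subframeClosure T ⊆ S := fun _ ha => ha S ⟨hS, h⟩

theorem image_subframeClosure (f : FrameHom L M) (T : Set L) :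
    f '' subframeClosure T = subframeClosure (f '' T) := by
  apply subset_antisymm
  · rw [Set.image_subset_iff]
    refine subframeClosure_subset ((subframeClosure_isSubframe _).preimage f) ?_
    rw [← Set.image_subset_iff]
    exact subset_subframeClosure _
  · exact subframeClosure_subset ((subframeClosure_isSubframe _).image f)
      (Set.image_mono (subset_subframeClosure _))

end

/-- A congruence on a frame `L`: an equivalence relation on `L` that is a subframe of `L × L`. -/
structure FrameCon (L : Type u) [Frame L] extends Setoid L where
  isSubframe : IsSubframe {p : L × L | r p.1 p.2}

namespace FrameCon

variable {L : Type u} {M : Type u} {N : Type u} [Frame L] [Frame M] [Frame N]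

theorem refl (C : FrameCon L) (a : L) : C.r a a := C.toSetoid.refl a
theorem symm (C : FrameCon L) {a b : L} (h : C.r a b) : C.r b a := C.toSetoid.symm h
theorem trans (C : FrameCon L) {a b c : L} (h : C.r a b) (h' : C.r b c) : C.r a c :=
  C.toSetoid.trans h h'

theorem inf (C : FrameCon L) {a b c d : L} (h : C.r a b) (h' : C.r c d) : C.r (a ⊓ c) (b ⊓ d) :=
  C.isSubframe.inf_mem (a, b) h (c, d) h'

theorem iSup (C : FrameCon L) {ι : Sort*} {f g : ι → L} (h : ∀ i, C.r (f i) (g i)) :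
    C.r (⨆ i, f i) (⨆ i, g i) := by
  have := C.isSubframe.iSup_mem (fun i => (f i, g i)) h
  simpa only [Set.mem_ofPred_eq, Prod.fst_iSup, Prod.snd_iSup] using this

theorem sup (C : FrameCon L) {a b c d : L} (h : C.r a b) (h' : C.r c d) :
    C.r (a ⊔ c) (b ⊔ d) := by
  rw [sup_eq_iSup, sup_eq_iSup]
  exact C.iSup (by rintro (_ | _) <;> assumption)

/-- Constructor from closure under binary meets and indexed joins. -/
def mk' (s : Setoid L) (hinf : ∀ a b c d, s a b → s c d → s (a ⊓ c) (b ⊓ d))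
    (hsup : ∀ (T : Set (L × L)), (∀ p ∈ T, s p.1 p.2) →
      s (⨆ p : T, p.1.1) (⨆ p : T, p.1.2)) : FrameCon L where
  toSetoid := s
  isSubframe :=
    { top_mem := s.refl _
      inf_mem := fun a ha b hb => hinf _ _ _ _ ha hb
      sSup_mem := fun T hT => by
        have := hsup T hT
        simpa only [Set.mem_ofPred_eq, Prod.fst_sSup, Prod.snd_sSup, sSup_image'] using this }

/-- Congruences are ordered by inclusion. -/
instance : PartialOrder (FrameCon L) :=
  PartialOrder.lift FrameCon.toSetoid (fun C D h => by cases C; cases D; cases h; rfl)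

theorem le_def {C D : FrameCon L} : C ≤ D ↔ ∀ a b, C.r a b → D.r a b :=
  ⟨fun h _ _ hab => h hab, fun h _ _ hab => h _ _ hab⟩

theorem ext {C D : FrameCon L} (h : ∀ a b, C.r a b ↔ D.r a b) : C = D :=
  le_antisymm (le_def.2 fun a b => (h a b).1) (le_def.2 fun a b => (h a b).2)

section

/-- Arbitrary meets of congruences are intersections. -/
@[reducible] def infSet : InfSet (FrameCon L) where
  sInf A := mk'
    { r := fun a b => ∀ C ∈ A, C.r a b
      iseqv := ⟨fun a C _ => C.refl a, fun h C hC => C.symm (h C hC),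
        fun h h' C hC => C.trans (h C hC) (h' C hC)⟩ }
    (fun _ _ _ _ h h' C hC => C.inf (h C hC) (h' C hC))
    (fun _ hT C hC => C.iSup fun p => hT p.1 p.2 C hC)

/-- Binary meets of congruences are intersections. -/
@[reducible] def minInst : Min (FrameCon L) where
  min C D := mk'
    { r := fun a b => C.r a b ∧ D.r a b
      iseqv := ⟨fun a => ⟨C.refl a, D.refl a⟩, fun h => ⟨C.symm h.1, D.symm h.2⟩,
        fun h h' => ⟨C.trans h.1 h'.1, D.trans h.2 h'.2⟩⟩ }
    (fun _ _ _ _ h h' => ⟨C.inf h.1 h'.1, D.inf h.2 h'.2⟩)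
    (fun _ hT => ⟨C.iSup fun p => (hT p.1 p.2).1, D.iSup fun p => (hT p.1 p.2).2⟩)

attribute [local instance] FrameCon.infSet FrameCon.minInst

/-- The complete lattice of congruences; binary meets are intersections. -/
@[reducible] def completeLattice : CompleteLattice (FrameCon L) :=
  { completeLatticeOfInf (FrameCon L) (fun _ =>
      ⟨fun C hC => le_def.2 fun _ _ h => h C hC,
        fun _ hD => le_def.2 fun a b h _ hC => le_def.1 (hD hC) a b h⟩) with
    inf := (· ⊓ ·)
    inf_le_left := fun _ _ => le_def.2 fun _ _ h => h.1
    inf_le_right := fun _ _ => le_def.2 fun _ _ h => h.2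
    le_inf := fun _ _ _ h h' => le_def.2 fun a b hab => ⟨le_def.1 h a b hab, le_def.1 h' a b hab⟩ }

attribute [local instance] FrameCon.completeLattice

/-- The nucleus of a congruence: it sends `a` to the largest element congruent to `a`. -/
def nuc (C : FrameCon L) : Nucleus L :=
  have key : ∀ a, C.r (sSup {b | C.r b a}) a := fun a => by
    have h := C.iSup (f := fun b : {b | C.r b a} => (b : L)) (g := fun _ => a) fun b => b.2
    rw [sSup_eq_iSup']
    have : Nonempty {b | C.r b a} := ⟨⟨a, C.refl a⟩⟩
    simpa using h
  have mono : ∀ a b, a ≤ b → sSup {c | C.r c a} ≤ sSup {c | C.r c b} := fun a b hab => by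
    have h := C.sup (key a) (C.refl b)
    rw [sup_eq_right.2 hab] at h
    exact le_sup_left.trans (le_sSup h)
  { toFun := fun a => sSup {b | C.r b a}
    map_inf' := fun a b => le_antisymm
      (le_inf (mono _ _ inf_le_left) (mono _ _ inf_le_right)) (le_sSup (C.inf (key a) (key b)))
    idempotent' := fun a => le_sSup (C.trans (key _) (key _))
    le_apply' := fun a => le_sSup (C.refl a) }

theorem nuc_apply (C : FrameCon L) (a : L) : C.nuc a = sSup {b | C.r b a} := rfl

theorem r_nuc (C : FrameCon L) (a : L) : C.r (C.nuc a) a := by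
  have h := C.iSup (f := fun b : {b | C.r b a} => (b : L)) (g := fun _ => a) fun b => b.2
  rw [nuc_apply, sSup_eq_iSup']
  have : Nonempty {b | C.r b a} := ⟨⟨a, C.refl a⟩⟩
  simpa using h

theorem r_iff_nuc {C : FrameCon L} {a b : L} : C.r a b ↔ C.nuc a = C.nuc b := by
  constructor
  · intro h
    exact le_antisymm (le_sSup (C.trans (C.r_nuc a) h)) (le_sSup (C.trans (C.r_nuc b) (C.symm h)))
  · intro h
    exact C.trans (C.symm (C.r_nuc a)) (h ▸ C.r_nuc b)

theorem le_iff_nuc {C D : FrameCon L} : C ≤ D ↔ C.nuc ≤ D.nuc := by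
  rw [le_def]
  constructor
  · intro h a
    exact le_sSup (h _ _ (C.r_nuc a))
  · intro h
    have key : ∀ a b, C.r a b → D.nuc a ≤ D.nuc b := fun a b hab => by
      have h1 : a ≤ D.nuc b := le_trans (b := C.nuc b) (le_sSup hab) (h b)
      simpa using D.nuc.monotone h1
    exact fun a b hab => r_iff_nuc.2 (le_antisymm (key a b hab) (key b a (C.symm hab)))

/-- The kernel of a nucleus. -/
def ofNucleus (n : Nucleus L) : FrameCon L :=
  mk' (Setoid.ker n)
    (fun a b c d h h' => by
      simp only [Setoid.ker_def] at *
      rw [n.map_inf, n.map_inf, h, h'])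
    (fun T hT => by
      have key : ∀ f g : T → L, (∀ p, n (f p) = n (g p)) → n (⨆ p, f p) ≤ n (⨆ p, g p) := by
        intro f g h
        have : ⨆ p, f p ≤ n (⨆ p, g p) := iSup_le fun p =>
          Nucleus.le_apply.trans ((h p).trans_le (n.monotone (le_iSup g p)))
        simpa using n.monotone this
      exact le_antisymm (key _ _ fun p => hT p.1 p.2) (key _ _ fun p => (hT p.1 p.2).symm))

/-- Congruences on `L` correspond to nuclei on `L`. -/
def orderIsoNucleus : FrameCon L ≃o Nucleus L where
  toFun := nuc
  invFun := ofNucleus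
  left_inv _ := ext fun _ _ => r_iff_nuc.symm
  right_inv n := Nucleus.ext fun a =>
    le_antisymm (sSup_le fun _ hb => Nucleus.le_apply.trans (le_of_eq hb))
      (le_sSup (n.idempotent a))
  map_rel_iff' := le_iff_nuc.symm

/-- The lattice of congruences on a frame is a frame. -/
instance : Frame (FrameCon L) := Frame.ofMinimalAxioms
  { inf_sSup_le_iSup_inf := fun C A => by
      rw [← orderIsoNucleus.le_iff_le, OrderIso.map_inf, OrderIso.map_sSup, inf_iSup₂_eq]
      simp only [OrderIso.map_iSup, OrderIso.map_inf]
      exact le_rfl }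

end

theorem sInf_r {A : Set (FrameCon L)} {a b : L} : (sInf A).r a b ↔ ∀ C ∈ A, C.r a b := Iff.rfl

theorem inf_r {C D : FrameCon L} {a b : L} : (C ⊓ D).r a b ↔ C.r a b ∧ D.r a b := Iff.rfl

/-! ### Quotients -/

/-- The underlying set of the quotient `L / C`. -/
def Quot (C : FrameCon L) : Type u := Quotient C.toSetoid

namespace Quot

variable (C : FrameCon L)

/-- The quotient map as a function. -/
def mk (a : L) : C.Quot := Quotient.mk C.toSetoid a

variable {C}

theorem mk_eq {a b : L} : mk C a = mk C b ↔ C.r a b := Quotient.eq (r := C.toSetoid)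

theorem mk_surjective : Function.Surjective (mk C) := Quotient.mk_surjective

/-- The largest representative of a class. -/
def top (x : C.Quot) : L := Quotient.lift C.nuc (fun _ _ h => r_iff_nuc.1 h) x

theorem top_mk (a : L) : top (mk C a) = C.nuc a := rfl

theorem mk_top (x : C.Quot) : mk C (top x) = x := by
  obtain ⟨a, rfl⟩ := mk_surjective x
  exact mk_eq.2 (C.r_nuc a)

/-- The order of the quotient: `x ≤ y` iff the largest representatives are so ordered,
equivalently iff `[a] = [a ⊓ b]` for all representatives, see `mk_le_mk`. -/
instance : PartialOrder C.Quot :=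
  PartialOrder.lift top fun x y h => by rw [← mk_top x, h, mk_top]

theorem le_def {x y : C.Quot} : x ≤ y ↔ top x ≤ top y := Iff.rfl

theorem mk_mono {a b : L} (h : a ≤ b) : mk C a ≤ mk C b := C.nuc.monotone h

theorem mk_le_iff {a : L} {x : C.Quot} : mk C a ≤ x ↔ a ≤ top x := by
  constructor
  · exact fun h => Nucleus.le_apply.trans h
  · intro h
    rw [← mk_top x]
    exact mk_mono h

theorem mk_le_mk {a b : L} : mk C a ≤ mk C b ↔ C.r (a ⊓ b) a := by
  rw [r_iff_nuc, Nucleus.map_inf, inf_eq_left]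
  rfl

section

/-- Arbitrary joins in the quotient. -/
@[reducible] def supSet : SupSet C.Quot where
  sSup T := mk C (sSup (top '' T))

/-- Binary meets are computed on representatives. -/
@[reducible] def minInst : Min C.Quot where
  min := Quotient.map₂ (· ⊓ ·) fun _ _ h _ _ h' => C.inf h h'

attribute [local instance] supSet minInst

theorem top_inf (x y : C.Quot) : top (x ⊓ y) = top x ⊓ top y := by
  obtain ⟨a, rfl⟩ := mk_surjective x
  obtain ⟨b, rfl⟩ := mk_surjective y
  exact C.nuc.map_inf

/-- The complete lattice structure of the quotient. -/
@[reducible] def completeLattice : CompleteLattice C.Quot :=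
  { completeLatticeOfSup C.Quot (fun T =>
      ⟨fun x hx => by
        rw [← mk_top x]
        exact mk_mono (le_sSup ⟨x, hx, rfl⟩),
      fun y hy => mk_le_iff.2 (sSup_le (by rintro _ ⟨x, hx, rfl⟩; exact hy hx))⟩) with
    inf := (· ⊓ ·)
    inf_le_left := fun x y => by rw [le_def, top_inf]; exact inf_le_left
    inf_le_right := fun x y => by rw [le_def, top_inf]; exact inf_le_right
    le_inf := fun x y z h h' => by rw [le_def, top_inf]; exact le_inf h h'
    top := mk C ⊤
    le_top := fun x => by rw [← mk_top x]; exact mk_mono le_top }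

/-- The quotient of a frame by a congruence is a frame. -/
instance : Frame C.Quot := @Frame.ofMinimalAxioms _ completeLattice <|
  let := @completeLattice L _ C
  { inf_sSup_le_iSup_inf := fun x T => by
      conv_lhs => rw [← mk_top x]
      change mk C (top x ⊓ sSup (top '' T)) ≤ _
      rw [mk_le_iff, inf_sSup_eq]
      refine iSup₂_le ?_
      rintro _ ⟨y, hy, rfl⟩
      rw [← top_inf]
      exact le_iSup₂ (f := fun b (_ : b ∈ T) => x ⊓ b) y hy }

end

end Quot

/-- The quotient map `L → L / C` as a frame homomorphism. -/
def quotHom (C : FrameCon L) : FrameHom L C.Quot where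
  toFun := Quot.mk C
  map_inf' _ _ := rfl
  map_top' := rfl
  map_sSup' T := le_antisymm
    (Quot.mk_le_iff.2 (sSup_le fun a ha => Quot.mk_le_iff.1 (le_sSup ⟨a, ha, rfl⟩)))
    (sSup_le (by rintro _ ⟨a, ha, rfl⟩; exact Quot.mk_mono (le_sSup ha)))

theorem quotHom_surjective (C : FrameCon L) : Function.Surjective C.quotHom := Quot.mk_surjective

theorem quotHom_eq {C : FrameCon L} {a b : L} : C.quotHom a = C.quotHom b ↔ C.r a b := Quot.mk_eq

end FrameCon

/-! ### Closed and open congruences, functoriality -/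

namespace FrameCon

variable {L : Type u} {M : Type u} {N : Type u} [Frame L] [Frame M] [Frame N]

/-- The congruence generated by a relation: the least congruence containing it. -/
def gen (R : L → L → Prop) : FrameCon L := sInf {C | ∀ a b, R a b → C.r a b}

theorem gen_le {R : L → L → Prop} {C : FrameCon L} : gen R ≤ C ↔ ∀ a b, R a b → C.r a b :=
  ⟨fun h _ _ hab => le_def.1 h _ _ fun _ hD => hD _ _ hab, fun h => sInf_le h⟩

/-- The closed congruence `∇_a = {(x, y) | x ∨ a = y ∨ a}`. -/
def closed (a : L) : FrameCon L :=
  mk' (Setoid.ker (· ⊔ a))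
    (fun x y z w h h' => by
      simp only [Setoid.ker_def] at *
      rw [sup_inf_right, sup_inf_right, h, h'])
    (fun T hT => by
      simp only [Setoid.ker_def] at *
      rcases isEmpty_or_nonempty T
      · simp
      · rw [iSup_sup, iSup_sup]
        exact iSup_congr fun p => hT p.1 p.2)

/-- The open congruence `Δ_a = {(x, y) | x ∧ a = y ∧ a}`. -/
def opn (a : L) : FrameCon L :=
  mk' (Setoid.ker (· ⊓ a))
    (fun x y z w h h' => by
      simp only [Setoid.ker_def] at *
      rw [inf_inf_distrib_right, inf_inf_distrib_right y, h, h'])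
    (fun T hT => by
      simp only [Setoid.ker_def] at *
      rw [iSup_inf_eq, iSup_inf_eq]
      exact iSup_congr fun p => hT p.1 p.2)

theorem closed_r {a x y : L} : (closed a).r x y ↔ x ⊔ a = y ⊔ a := Iff.rfl

theorem opn_r {a x y : L} : (opn a).r x y ↔ x ⊓ a = y ⊓ a := Iff.rfl

theorem closed_le {a : L} {C : FrameCon L} : closed a ≤ C ↔ C.r ⊥ a := by
  rw [le_def]
  constructor
  · intro h
    exact h _ _ (by simp [closed_r])
  · intro h x y hxy
    rw [closed_r] at hxy
    have h1 := C.sup (C.refl x) h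
    have h2 := C.sup (C.refl y) h
    rw [sup_bot_eq] at h1 h2
    exact C.trans h1 (hxy ▸ C.symm h2)

/-- The congruence `{(x, y) | (x ∨ a, y ∨ a) ∈ C}`, which is the join of `C` and `∇_a`. -/
theorem sup_closed_r {C : FrameCon L} {a x y : L} :
    (C ⊔ closed a).r x y ↔ C.r (x ⊔ a) (y ⊔ a) := by
  constructor
  · let D : FrameCon L := mk'
      { r := fun x y => C.r (x ⊔ a) (y ⊔ a)
        iseqv := ⟨fun _ => C.refl _, C.symm, C.trans⟩ }
      (fun x y z w h h' => by
        change C.r _ _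
        rw [sup_inf_right, sup_inf_right]
        exact C.inf h h')
      (fun T hT => by
        change C.r _ _
        rcases isEmpty_or_nonempty T
        · simp
        · rw [iSup_sup, iSup_sup]
          exact C.iSup fun p => hT p.1 p.2)
    have hD : C ⊔ closed a ≤ D := sup_le (le_def.2 fun x y h => C.sup h (C.refl a))
      (closed_le.2 (by change C.r _ _; simp))
    exact fun h => le_def.1 hD _ _ h
  · intro h
    have h1 : ∀ z, (C ⊔ closed a).r z (z ⊔ a) := fun z =>
      le_def.1 le_sup_right _ _ (by simp [closed_r])
    exact FrameCon.trans _ (h1 x) (FrameCon.trans _ (le_def.1 le_sup_left _ _ h)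
      (FrameCon.symm _ (h1 y)))

theorem closed_sup_eq_iff {C : FrameCon L} {a b : L} :
    C ⊔ closed a = C ⊔ closed b ↔ C.r a b := by
  have key : ∀ a b : L, closed a ≤ C ⊔ closed b ↔ C.r b (a ⊔ b) := fun a b => by
    rw [closed_le, sup_closed_r, bot_sup_eq]
  constructor
  · intro h
    have h1 := (key a b).1 (h ▸ le_sup_right)
    have h2 := (key b a).1 (h ▸ le_sup_right)
    rw [sup_comm] at h2
    exact C.trans h2 (C.symm h1)
  · intro h
    refine le_antisymm (sup_le le_sup_left ((key a b).2 ?_)) (sup_le le_sup_left ((key b a).2 ?_))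
    · simpa using C.symm (C.sup h (C.refl b))
    · simpa using C.sup h (C.refl a)

/-- `∇_a` and `Δ_a` are complements of each other. -/
theorem isCompl_closed_opn (a : L) : IsCompl (closed a) (opn a) := by
  rw [isCompl_iff, disjoint_iff, codisjoint_iff]
  constructor
  · refine le_bot_iff.1 (le_def.2 fun x y h => ?_)
    have h1 : x ⊔ a = y ⊔ a := h.1
    have h2 : x ⊓ a = y ⊓ a := h.2
    rw [eq_of_inf_eq_sup_eq h2 h1]
  · refine top_le_iff.1 (le_def.2 fun x y _ => ?_)
    rw [sup_comm, sup_closed_r, opn_r, inf_eq_right.2 le_sup_right, inf_eq_right.2 le_sup_right]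

/-- The frame homomorphism `∇ : L → C L`, `a ↦ ∇_a`. -/
def nabla (L : Type u) [Frame L] : FrameHom L (FrameCon L) where
  toFun := closed
  map_inf' a b := by
    have mono : ∀ c d : L, c ≤ d → closed c ≤ closed d := fun c d h =>
      closed_le.2 (by simp [closed_r, h])
    refine le_antisymm (le_inf (mono _ _ inf_le_left) (mono _ _ inf_le_right))
      (le_def.2 fun x y h => ?_)
    have h1 : x ⊔ a = y ⊔ a := h.1
    have h2 : x ⊔ b = y ⊔ b := h.2
    rw [closed_r, sup_inf_left, sup_inf_left, h1, h2]
  map_top' := top_le_iff.1 (le_def.2 fun x y _ => by simp [closed_r])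
  map_sSup' T := le_antisymm
    (closed_le.2 (by
      have h := FrameCon.iSup (sSup (closed '' T)) (f := fun _ : T => (⊥ : L)) (g := fun a => a.1)
        fun a => closed_le.1 (le_sSup ⟨a, a.2, rfl⟩)
      rwa [iSup_bot, ← sSup_eq_iSup'] at h))
    (sSup_le (by
      rintro _ ⟨a, ha, rfl⟩
      exact closed_le.2 (by simp [closed_r, le_sSup ha])))

/-- The preimage of a congruence under a frame homomorphism. -/
def comap (f : FrameHom L M) (D : FrameCon M) : FrameCon L :=
  mk' (D.toSetoid.comap f)
    (fun a b c d h h' => by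
      simp only [Setoid.comap_rel, map_inf] at *
      exact D.inf h h')
    (fun T hT => by
      simp only [Setoid.comap_rel, map_iSup] at *
      exact D.iSup fun p => hT p.1 p.2)

theorem comap_r {f : FrameHom L M} {D : FrameCon M} {a b : L} :
    (comap f D).r a b ↔ D.r (f a) (f b) := Iff.rfl

theorem bot_r {a b : L} : (⊥ : FrameCon L).r a b ↔ a = b := by
  constructor
  · intro h
    have h1 : (closed (⊥ : L)).r a b := le_def.1 bot_le _ _ h
    simpa [closed_r] using h1
  · rintro rfl
    exact FrameCon.refl _ _

/-- The kernel `{(a, b) | f a = f b}` of a frame homomorphism. -/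
def ker (f : FrameHom L M) : FrameCon L := comap f ⊥

theorem ker_r {f : FrameHom L M} {a b : L} : (ker f).r a b ↔ f a = f b := bot_r

/-- The congruence on `M` generated by the image of a congruence on `L` under `f × f`. -/
def mapFun (f : FrameHom L M) (C : FrameCon L) : FrameCon M :=
  gen fun x y => ∃ a b, C.r a b ∧ f a = x ∧ f b = y

theorem mapFun_le {f : FrameHom L M} {C : FrameCon L} {D : FrameCon M} :
    mapFun f C ≤ D ↔ C ≤ comap f D := by
  rw [mapFun, gen_le, le_def]
  constructor
  · exact fun h a b hab => h _ _ ⟨a, b, hab, rfl, rfl⟩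
  · rintro h _ _ ⟨a, b, hab, rfl, rfl⟩
    exact h a b hab

/-- The function underlying `lift`. -/
def liftFun (g : FrameHom L N) (C : FrameCon L) : N :=
  ⨆ p : {p : L × L // C.r p.1 p.2}, g p.1.2 ⊓ (g p.1.1)ᶜ

theorem le_liftFun (g : FrameHom L N) {C : FrameCon L} {a b : L} (h : C.r a b) :
    g b ⊓ (g a)ᶜ ≤ liftFun g C :=
  le_iSup (fun p : {p : L × L // C.r p.1 p.2} => g p.1.2 ⊓ (g p.1.1)ᶜ) ⟨(a, b), h⟩

theorem gc_liftFun (g : FrameHom L N) (hg : ∀ a, IsComplemented (g a)) :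
    GaloisConnection (liftFun g) fun n => comap g (closed n) := fun C n => by
  have compl : ∀ a, IsCompl (g a) (g a)ᶜ := fun a => by
    obtain ⟨c, hc⟩ := hg a
    rwa [hc.compl_eq]
  have aux : ∀ a b, g b ⊓ (g a)ᶜ ≤ n ↔ g b ≤ g a ⊔ n := fun a b => by
    rw [← (compl a).symm.le_sup_right_iff_inf_left_le, sup_comm]
  constructor
  · intro h
    refine le_def.2 fun a b hab => ?_
    change g a ⊔ n = g b ⊔ n
    exact le_antisymm
      (sup_le ((aux b a).1 ((le_liftFun g (C.symm hab)).trans h)) le_sup_right)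
      (sup_le ((aux a b).1 ((le_liftFun g hab).trans h)) le_sup_right)
  · intro h
    refine iSup_le fun p => (aux _ _).2 ?_
    have : g p.1.1 ⊔ n = g p.1.2 ⊔ n := le_def.1 h _ _ p.2
    rw [this]
    exact le_sup_left

/-- The universal property of `∇ : L → C L`: a frame homomorphism `g : L → N` all of whose values
are complemented extends to `C L`, by `C ↦ ⋁ {g b ∧ (g a)ᶜ | (a, b) ∈ C}`. -/
def lift (g : FrameHom L N) (hg : ∀ a, IsComplemented (g a)) : FrameHom (FrameCon L) N where
  toFun := liftFun g
  map_top' := top_le_iff.1 ((le_liftFun g (le_def.1 (le_top (a := closed ⊤)) ⊥ ⊤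
    (by simp [closed_r]))).trans' (by simp))
  map_inf' C D := by
    refine le_antisymm (le_inf ((gc_liftFun g hg).monotone_l inf_le_left)
      ((gc_liftFun g hg).monotone_l inf_le_right)) ?_
    change (⨆ p, _) ⊓ (⨆ q, _) ≤ _
    rw [iSup_inf_iSup]
    refine iSup_le fun ⟨⟨⟨a, b⟩, h⟩, ⟨⟨a', b'⟩, h'⟩⟩ => ?_
    have key : ∀ (E : FrameCon L) (a a' b b' : L), E.r a b →
        E.r (a ⊔ a') (a ⊔ a' ⊔ b ⊓ b') := fun E a a' b b' h => by
      have h1 := E.sup (E.refl (a ⊔ a')) (E.inf h (E.refl b'))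
      have h2 : a ⊔ a' ⊔ a ⊓ b' = a ⊔ a' :=
        sup_eq_left.2 (inf_le_left.trans le_sup_left)
      rwa [h2] at h1
    have hD := key D a' a b' b h'
    rw [sup_comm a' a, inf_comm b' b] at hD
    refine (le_liftFun g (C := C ⊓ D) ⟨key C a a' b b' h, hD⟩).trans' ?_
    simp only [map_sup, map_inf, compl_sup]
    refine le_inf (le_sup_of_le_right ?_) ?_
    · exact le_inf (inf_le_left.trans inf_le_left) (inf_le_right.trans inf_le_left)
    · exact le_inf (inf_le_left.trans inf_le_right) (inf_le_right.trans inf_le_right)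
  map_sSup' T := by rw [(gc_liftFun g hg).l_sSup, sSup_image]

theorem lift_le {g : FrameHom L N} {hg : ∀ a, IsComplemented (g a)} {C : FrameCon L} {n : N} :
    lift g hg C ≤ n ↔ C ≤ comap g (closed n) := gc_liftFun g hg C n

theorem comap_closed_r {g : FrameHom L N} {n : N} {a b : L} :
    (comap g (closed n)).r a b ↔ g a ⊔ n = g b ⊔ n := Iff.rfl

theorem lift_closed (g : FrameHom L N) (hg : ∀ a, IsComplemented (g a)) (a : L) :
    lift g hg (closed a) = g a := by
  refine eq_of_forall_ge_iff fun n => ?_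
  rw [lift_le, closed_le, comap_closed_r, map_bot, bot_sup_eq, eq_comm, sup_eq_right]

theorem isComplemented_nabla (a : L) : IsComplemented (nabla L a) := ⟨_, isCompl_closed_opn a⟩

theorem isComplemented_nabla_comp (f : FrameHom L M) (a : L) :
    IsComplemented ((nabla M).comp f a) := isComplemented_nabla (f a)

theorem mapFun_eq_lift (f : FrameHom L M) (C : FrameCon L) :
    mapFun f C = lift ((nabla M).comp f) (isComplemented_nabla_comp f) C := by
  refine eq_of_forall_ge_iff fun D => ?_
  rw [mapFun_le, lift_le]
  have : comap f D = comap ((nabla M).comp f) (closed D) := ext fun a b => by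
    rw [comap_closed_r, comap_r, ← closed_sup_eq_iff, sup_comm, sup_comm D]
    rfl
  rw [this]

/-- The frame homomorphism `C f : C L → C M`, which sends `C` to the congruence generated by the
image of `C` under `f × f`. -/
def map (f : FrameHom L M) : FrameHom (FrameCon L) (FrameCon M) where
  toFun := mapFun f
  map_inf' C D := by simp only [mapFun_eq_lift, map_inf]
  map_top' := by simp only [mapFun_eq_lift, map_top]
  map_sSup' T := by
    rw [mapFun_eq_lift, map_sSup]
    congr 1
    exact Set.image_congr fun C _ => (mapFun_eq_lift f C).symm

theorem map_le {f : FrameHom L M} {C : FrameCon L} {D : FrameCon M} :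
    map f C ≤ D ↔ C ≤ comap f D := mapFun_le

theorem map_closed (f : FrameHom L M) (a : L) : map f (closed a) = closed (f a) :=
  (mapFun_eq_lift f _).trans (lift_closed _ _ a)

theorem map_opn (f : FrameHom L M) (a : L) : map f (opn a) = opn (f a) := by
  have h : IsCompl (map f (closed a)) (map f (opn a)) := (isCompl_closed_opn a).map (map f)
  rw [map_closed] at h
  exact h.right_unique (isCompl_closed_opn (f a))

theorem map_id (C : FrameCon L) : map (FrameHom.id L) C = C :=
  eq_of_forall_ge_iff fun _ => map_le

theorem map_comp (g : FrameHom M N) (f : FrameHom L M) (C : FrameCon L) :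
    map (g.comp f) C = map g (map f C) :=
  eq_of_forall_ge_iff fun D => by
    rw [map_le, map_le, map_le]
    exact Iff.rfl

/-- A congruence `C` on `L` is the join of the congruences `∇_b ∧ Δ_a` for `(a, b) ∈ C`. -/
theorem eq_iSup (C : FrameCon L) :
    C = ⨆ p : {p : L × L // C.r p.1 p.2}, closed p.1.2 ⊓ opn p.1.1 := by
  apply le_antisymm
  · refine le_def.2 fun a b hab => ?_
    have key : ∀ a b, C.r a b →
        (⨆ p : {p : L × L // C.r p.1 p.2}, closed p.1.2 ⊓ opn p.1.1).r a (a ⊔ b) := by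
      intro a b hab
      have h1 : C.r a (a ⊔ b) := by simpa using C.sup (C.refl a) hab
      refine le_def.1 (le_iSup (fun p : {p : L × L // C.r p.1 p.2} =>
        closed p.1.2 ⊓ opn p.1.1) ⟨(a, a ⊔ b), h1⟩) _ _ ⟨?_, ?_⟩
      · change a ⊔ (a ⊔ b) = a ⊔ b ⊔ (a ⊔ b)
        simp
      · change a ⊓ a = (a ⊔ b) ⊓ a
        simp
    have h2 := key b a (C.symm hab)
    rw [sup_comm] at h2
    exact FrameCon.trans _ (key a b hab) (FrameCon.symm _ h2)
  · refine iSup_le fun p => ?_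
    have h1 : closed p.1.2 ≤ C ⊔ closed p.1.1 :=
      le_sup_right.trans (closed_sup_eq_iff.2 p.2).ge
    refine (inf_le_inf_right _ h1).trans ?_
    rw [inf_sup_right, (isCompl_closed_opn _).inf_eq_bot, sup_bot_eq]
    exact inf_le_left

/-- A congruence `C` is dense if the quotient map `L → L / C` is dense. -/
def IsDense (C : FrameCon L) : Prop := ∀ a : L, C.quotHom a = ⊥ → a = ⊥

/-- The largest dense congruence `𝔇_L` on `L`, defined as the join of all the dense ones. -/
def largestDense (L : Type u) [Frame L] : FrameCon L := sSup {C | C.IsDense}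

theorem isDense_iff {C : FrameCon L} : C.IsDense ↔ ∀ a, C.r a ⊥ → a = ⊥ := by
  have : ∀ a, C.quotHom a = ⊥ ↔ C.r a ⊥ := fun a => by
    rw [← quotHom_eq, BotHomClass.map_bot]
  simp only [IsDense, this]

end FrameCon

/-- The congruence frame functor `C : Frm ⥤ Frm`. -/
def congFunctor : Frm.{u} ⥤ Frm.{u} where
  obj L := Frm.of (FrameCon L)
  map f := Frm.ofHom (FrameCon.map f.hom)
  map_id L := by
    ext C
    exact FrameCon.map_id C
  map_comp f g := by
    ext C
    exact FrameCon.map_comp g.hom f.hom C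

/-! ### Biframes -/

/-- A biframe: a frame (the total part) with two subframes (the first and second parts) which
together generate it. -/
structure BiFrm where
  total : Type u
  [frame : Frame total]
  first : Set total
  second : Set total
  isSubframe_first : IsSubframe first
  isSubframe_second : IsSubframe second
  generate : subframeClosure (first ∪ second) = Set.univ

attribute [instance] BiFrm.frame

namespace BiFrm

/-- A biframe homomorphism: a frame homomorphism of total parts preserving the parts. -/
@[ext]
structure Hom (A B : BiFrm.{u}) where
  toFrameHom : FrameHom A.total B.total
  map_first : ∀ a ∈ A.first, toFrameHom a ∈ B.first
  map_second : ∀ a ∈ A.second, toFrameHom a ∈ B.second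

/-- The category of biframes. -/
instance : Category BiFrm.{u} where
  Hom A B := Hom A B
  id A := ⟨FrameHom.id A.total, fun _ h => h, fun _ h => h⟩
  comp f g := ⟨g.toFrameHom.comp f.toFrameHom, fun a h => g.map_first _ (f.map_first a h),
    fun a h => g.map_second _ (f.map_second a h)⟩

/-- The first part of a biframe is a frame. -/
instance (A : BiFrm.{u}) : Frame A.first := A.isSubframe_first.frame

/-- The restriction of a biframe homomorphism to the first parts. -/
def Hom.firstHom {A B : BiFrm.{u}} (f : Hom A B) : FrameHom A.first B.first where
  toFun a := ⟨f.toFrameHom a, f.map_first _ a.2⟩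
  map_inf' a b := Subtype.ext (map_inf f.toFrameHom (a : A.total) (b : A.total))
  map_top' := Subtype.ext (map_top f.toFrameHom)
  map_sSup' T := Subtype.ext (by
    change f.toFrameHom (sSup (Subtype.val '' T)) = sSup (Subtype.val '' _)
    rw [map_sSup, Set.image_image, Set.image_image])

/-- The first part functor on biframes. -/
def firstPart : BiFrm.{u} ⥤ Frm.{u} where
  obj A := Frm.of A.first
  map f := Frm.ofHom f.firstHom

/-- The inclusion of the first part into the total part. -/
def firstIncl (A : BiFrm.{u}) : FrameHom A.first A.total where
  toFun := Subtype.val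
  map_inf' _ _ := rfl
  map_top' := rfl
  map_sSup' _ := rfl

/-- A biframe is strictly zero-dimensional if every element of the first part is complemented
in the total part with complement lying in the second part, and these complements generate the
second part. -/
structure IsStrictlyZeroDimensional (A : BiFrm.{u}) : Prop where
  exists_compl : ∀ a ∈ A.first, ∃ c ∈ A.second, IsCompl a c
  generate_second : subframeClosure {c | ∃ a ∈ A.first, IsCompl a c} = A.second

end BiFrm

/-- The category of strictly zero-dimensional biframes and biframe homomorphisms. -/
abbrev Str0DBiFrm := ObjectProperty.FullSubcategory BiFrm.IsStrictlyZeroDimensional.{u}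

/-- The first part functor `P : Str0DBiFrm ⥤ Frm`. -/
def firstPartFunctor : Str0DBiFrm.{u} ⥤ Frm.{u} :=
  ObjectProperty.ι BiFrm.IsStrictlyZeroDimensional ⋙ BiFrm.firstPart

/-- The congruence biframe `(C L, ∇ L, Δ L)`, where `∇ L` is the subframe of closed congruences
and `Δ L` is the subframe generated by the open congruences. -/
def congBiFrm (L : Type u) [Frame L] : BiFrm.{u} where
  total := FrameCon L
  first := Set.range FrameCon.closed
  second := subframeClosure (Set.range FrameCon.opn)
  isSubframe_first := by
    have := (IsSubframe.univ (L := L)).image (FrameCon.nabla L)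
    rwa [Set.image_univ] at this
  isSubframe_second := subframeClosure_isSubframe _
  generate := by
    refine Set.eq_univ_of_forall fun C => ?_
    have h := subframeClosure_isSubframe
      (Set.range FrameCon.closed ∪ subframeClosure (Set.range (FrameCon.opn (L := L))))
    rw [FrameCon.eq_iSup C]
    refine h.iSup_mem _ fun p => h.inf_mem _ ?_ _ ?_
    · exact subset_subframeClosure _ (Or.inl ⟨_, rfl⟩)
    · exact subset_subframeClosure _ (Or.inr (subset_subframeClosure _ ⟨_, rfl⟩))

theorem congBiFrm_str0d (L : Type u) [Frame L] : (congBiFrm L).IsStrictlyZeroDimensional where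
  exists_compl := by
    rintro _ ⟨a, rfl⟩
    exact ⟨_, subset_subframeClosure _ ⟨a, rfl⟩, FrameCon.isCompl_closed_opn a⟩
  generate_second := by
    change _ = subframeClosure (Set.range FrameCon.opn)
    congr 1
    ext C
    constructor
    · rintro ⟨_, ⟨a, rfl⟩, h⟩
      exact ⟨a, (FrameCon.isCompl_closed_opn a).right_unique h⟩
    · rintro ⟨a, rfl⟩
      exact ⟨_, ⟨a, rfl⟩, FrameCon.isCompl_closed_opn a⟩

/-- The quotient of a biframe by a congruence on its total part: the parts of the quotient are
the images of the parts. -/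
def BiFrm.quot (A : BiFrm.{u}) (C : FrameCon A.total) : BiFrm.{u} where
  total := C.Quot
  first := C.quotHom '' A.first
  second := C.quotHom '' A.second
  isSubframe_first := A.isSubframe_first.image _
  isSubframe_second := A.isSubframe_second.image _
  generate := by
    rw [← Set.image_union, ← image_subframeClosure, A.generate, Set.image_univ,
      C.quotHom_surjective.range_eq]

theorem BiFrm.quot_str0d {A : BiFrm.{u}} (hA : A.IsStrictlyZeroDimensional)
    (C : FrameCon A.total) : (A.quot C).IsStrictlyZeroDimensional where
  exists_compl := by
    rintro _ ⟨a, ha, rfl⟩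
    obtain ⟨c, hc, h⟩ := hA.exists_compl a ha
    exact ⟨_, ⟨c, hc, rfl⟩, h.map C.quotHom⟩
  generate_second := by
    change _ = C.quotHom '' A.second
    rw [← hA.generate_second, image_subframeClosure]
    congr 1
    ext c
    constructor
    · rintro ⟨_, ⟨a, ha, rfl⟩, h⟩
      obtain ⟨c', -, h'⟩ := hA.exists_compl a ha
      exact ⟨c', ⟨a, ha, h'⟩, (h'.map C.quotHom).right_unique h⟩
    · rintro ⟨c', ⟨a, ha, h⟩, rfl⟩
      exact ⟨_, ⟨a, ha, rfl⟩, h.map C.quotHom⟩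

/-! ### The Grothendieck construction `∫ C²` -/

/-- The functor `C² = C ∘ C : Frm ⥤ Frm`, followed by the inclusion of frames in categories (via
their underlying preorders). -/
def congSqCat : Frm.{u} ⥤ Cat.{u, u} :=
  (congFunctor ⋙ congFunctor) ⋙ forget₂ Frm Lat ⋙ forget₂ Lat PartOrd ⋙ forget₂ PartOrd Preord ⋙
    preordToCat

/-- The Grothendieck construction `∫ C²`. Its objects are pairs `(L, C)` of a frame `L` and a
congruence `C` on `C L`; its morphisms `(L, C) ⟶ (L', C')` are the frame homomorphisms
`f : L ⟶ L'` with `C² f (C) ≤ C'`. -/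
abbrev IntCongSq := Grothendieck congSqCat.{u}

namespace IntCongSq

/-- The object `(L, C)` of `∫ C²`. -/
def mk (L : Frm.{u}) (C : FrameCon (FrameCon L)) : IntCongSq.{u} := ⟨L, C⟩

/-- The second component of an object `(L, C)` of `∫ C²`. -/
def con (X : IntCongSq.{u}) : FrameCon (FrameCon X.base) := X.fiber

theorem map_con_le {X Y : IntCongSq.{u}} (f : X ⟶ Y) :
    FrameCon.map (FrameCon.map f.base.hom) X.con ≤ Y.con :=
  leOfHom (X := FrameCon (FrameCon Y.base)) f.fiber

/-- The morphism of `∫ C²` given by `f` with `C² f (C) ≤ C'`. -/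
def homMk {X Y : IntCongSq.{u}} (f : X.base ⟶ Y.base)
    (h : FrameCon.map (FrameCon.map f.hom) X.con ≤ Y.con) : X ⟶ Y where
  base := f
  fiber := homOfLE (X := FrameCon (FrameCon Y.base)) h

theorem hom_ext {X Y : IntCongSq.{u}} {f g : X ⟶ Y} (h : f.base = g.base) : f = g := by
  refine Grothendieck.ext f g h ?_
  have : Subsingleton ((congSqCat.map g.base).toFunctor.obj X.fiber ⟶ Y.fiber) :=
    inferInstanceAs (Subsingleton (FrameCon.map (FrameCon.map g.base.hom) X.con ⟶ Y.con))
  exact Subsingleton.elim _ _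

end IntCongSq

/-! ### The functors relating `∫ C²` and strictly zero-dimensional biframes -/

/-- A frame homomorphism `L → M` induces `L / C → M / D` if its `C f` sends `C` below `D`. -/
def FrameCon.quotMap {L M : Type u} [Frame L] [Frame M] (f : FrameHom L M) {C : FrameCon L}
    {D : FrameCon M} (h : FrameCon.map f C ≤ D) : FrameHom C.Quot D.Quot :=
  have key : ∀ a b, C.r a b → D.r (f a) (f b) := FrameCon.le_def.1 (FrameCon.map_le.1 h)
  have surj : Function.Surjective (FrameCon.Quot.mk C) := FrameCon.Quot.mk_surjective
  { toFun := Quotient.lift (fun a => D.quotHom (f a)) fun a b hab =>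
      FrameCon.quotHom_eq.2 (key a b hab)
    map_inf' := fun x y => by
      obtain ⟨a, rfl⟩ := surj x
      obtain ⟨b, rfl⟩ := surj y
      change D.quotHom (f (a ⊓ b)) = D.quotHom (f a) ⊓ D.quotHom (f b)
      rw [map_inf, map_inf]
    map_top' := by
      change D.quotHom (f ⊤) = ⊤
      rw [map_top, map_top]
    map_sSup' := fun T => by
      change D.quotHom (f (sSup (FrameCon.Quot.top '' T))) = _
      rw [map_sSup, map_sSup, Set.image_image, Set.image_image]
      congr 1
      refine Set.image_congr fun x _ => ?_
      conv_rhs => rw [← FrameCon.Quot.mk_top x]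
      rfl }

theorem FrameCon.quotMap_mk {L M : Type u} [Frame L] [Frame M] (f : FrameHom L M) {C : FrameCon L}
    {D : FrameCon M} (h : FrameCon.map f C ≤ D) (a : L) :
    FrameCon.quotMap f h (C.quotHom a) = D.quotHom (f a) := rfl

/-- The functor sending `(L, C)` to the biframe quotient `C L / C` of the congruence biframe, and
a morphism `f` to the map induced by `C f`. -/
def quotFunctor : IntCongSq.{u} ⥤ Str0DBiFrm.{u} where
  obj X := ⟨(congBiFrm X.base).quot X.con, BiFrm.quot_str0d (congBiFrm_str0d X.base) X.con⟩
  map {X Y} f := ObjectProperty.homMk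
    { toFrameHom := FrameCon.quotMap (FrameCon.map f.base.hom) (IntCongSq.map_con_le f)
      map_first := by
        rintro _ ⟨_, ⟨a, rfl⟩, rfl⟩
        exact ⟨_, ⟨f.base.hom a, rfl⟩, by rw [← FrameCon.map_closed]; rfl⟩
      map_second := by
        rintro _ ⟨C, hC, rfl⟩
        refine ⟨FrameCon.map f.base.hom C, ?_, rfl⟩
        refine subframeClosure_subset
          ((subframeClosure_isSubframe _).preimage (FrameCon.map f.base.hom)) ?_ hC
        rintro _ ⟨a, rfl⟩
        rw [Set.mem_preimage, FrameCon.map_opn]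
        exact subset_subframeClosure _ ⟨_, rfl⟩ }
  map_id X := by
    apply ObjectProperty.hom_ext
    apply BiFrm.Hom.ext
    refine DFunLike.ext _ _ fun x => ?_
    obtain ⟨C, rfl⟩ := FrameCon.quotHom_surjective _ x
    exact congrArg (FrameCon.quotHom X.con) (FrameCon.map_id C)
  map_comp {X Y Z} f g := by
    apply ObjectProperty.hom_ext
    apply BiFrm.Hom.ext
    refine DFunLike.ext _ _ fun x => ?_
    obtain ⟨C, rfl⟩ := FrameCon.quotHom_surjective _ x
    exact congrArg (FrameCon.quotHom Z.con) (FrameCon.map_comp g.base.hom f.base.hom C)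

/-- The quotient map `C L → C L / C` onto the total part of the biframe `C L / C`. -/
def quotProj (X : IntCongSq.{u}) : FrameHom (FrameCon X.base) (quotFunctor.obj X).obj.total :=
  FrameCon.quotHom X.con

theorem isComplemented_firstIncl (M : Str0DBiFrm.{u}) (a : M.obj.first) :
    IsComplemented (M.obj.firstIncl a) := by
  obtain ⟨c, -, h⟩ := M.property.exists_compl a a.2
  exact ⟨c, h⟩

/-- The congruential coreflection `χ : C M₁ → M` (on total parts): the unique extension to
`C M₁` of the inclusion of `M₁` in `M₀`. -/
def chi (M : Str0DBiFrm.{u}) : FrameHom (FrameCon (firstPartFunctor.obj M)) M.obj.total :=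
  FrameCon.lift M.obj.firstIncl (isComplemented_firstIncl M)

theorem chi_closed (M : Str0DBiFrm.{u}) (a : firstPartFunctor.obj M) :
    chi M (FrameCon.closed a) = M.obj.firstIncl a :=
  FrameCon.lift_closed _ _ _

/-- Frame homomorphisms on `C L` are determined by their values on closed congruences. -/
theorem FrameCon.hom_ext {L N : Type u} [Frame L] [Frame N] {f g : FrameHom (FrameCon L) N}
    (h : ∀ a, f (FrameCon.closed a) = g (FrameCon.closed a)) : f = g := by
  have h' : ∀ a, f (FrameCon.opn a) = g (FrameCon.opn a) := fun a => by
    have hf := (FrameCon.isCompl_closed_opn a).map f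
    have hg := (FrameCon.isCompl_closed_opn a).map g
    rw [h] at hf
    exact hf.right_unique hg
  refine DFunLike.ext _ _ fun C => ?_
  rw [FrameCon.eq_iSup C, map_iSup, map_iSup]
  simp only [map_inf, h, h']

theorem chi_naturality {M N : Str0DBiFrm.{u}} (f : M ⟶ N)
    (C : FrameCon (firstPartFunctor.obj M)) :
    chi N (FrameCon.map (firstPartFunctor.map f).hom C) = f.hom.toFrameHom (chi M C) := by
  have : (chi N).comp (FrameCon.map (firstPartFunctor.map f).hom) =
      f.hom.toFrameHom.comp (chi M) := FrameCon.hom_ext fun a => by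
    change chi N (FrameCon.map _ _) = f.hom.toFrameHom (chi M _)
    rw [FrameCon.map_closed, chi_closed, chi_closed]
    rfl
  exact DFunLike.congr_fun this C

/-- The embedding of strictly zero-dimensional biframes in `∫ C²`, which sends `M ≅ C M₁ / C` to
`(M₁, C)`, where `C` is the kernel of the congruential coreflection `χ : C M₁ → M`. -/
def kerEmbedding : Str0DBiFrm.{u} ⥤ IntCongSq.{u} where
  obj M := IntCongSq.mk (firstPartFunctor.obj M) (FrameCon.ker (chi M))
  map {M N} f := IntCongSq.homMk (firstPartFunctor.map f) (by
    refine FrameCon.map_le.2 (FrameCon.le_def.2 fun C D h => ?_)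
    have h1 : chi M C = chi M D := FrameCon.ker_r.1 h
    refine FrameCon.ker_r.2 ?_
    exact (chi_naturality f C).trans
      ((congrArg f.hom.toFrameHom h1).trans (chi_naturality f D).symm))
  map_id M := IntCongSq.hom_ext (firstPartFunctor.map_id M)
  map_comp f g := IntCongSq.hom_ext (firstPartFunctor.map_comp f g)

/-! ### Topological and solid functors -/

section

universe v₁ v₂ u₁ u₂

variable {A : Type u₁} [Category.{v₁} A] {B : Type u₂} [Category.{v₂} B]

/-- A source `(m i : X ⟶ Y i)` is initial for `G` if, for every source `(n i : Z ⟶ Y i)` and every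
`h : G Z ⟶ G X` with `G (n i) = h ≫ G (m i)`, there is a unique `k : Z ⟶ X` with `G k = h` and
`n i = k ≫ m i`. -/
def IsInitialSource (G : A ⥤ B) {I : Type w} {X : A} {Y : I → A} (m : ∀ i, X ⟶ Y i) : Prop :=
  ∀ (Z : A) (n : ∀ i, Z ⟶ Y i) (h : G.obj Z ⟶ G.obj X),
    (∀ i, G.map (n i) = h ≫ G.map (m i)) → ∃! k : Z ⟶ X, G.map k = h ∧ ∀ i, n i = k ≫ m i

/-- An initial lift of a structured source `(f i : X ⟶ G (Y i))`. -/
structure InitialLift (G : A ⥤ B) {I : Type w} {X : B} {Y : I → A}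
    (f : ∀ i, X ⟶ G.obj (Y i)) where
  obj : A
  obj_eq : G.obj obj = X
  map : ∀ i, obj ⟶ Y i
  map_eq : ∀ i, G.map (map i) = eqToHom obj_eq ≫ f i
  isInitial : IsInitialSource G map

/-- A functor is topological if every structured source, of any size, has a unique initial lift. -/
def IsTopologicalFunctor (G : A ⥤ B) : Prop :=
  ∀ (I : Type w) (X : B) (Y : I → A) (f : ∀ i, X ⟶ G.obj (Y i)), Nonempty (Unique (InitialLift G f))

/-- `g : X ⟶ G Z` is a semifinal arrow for a structured sink `(f i : G (Y i) ⟶ X)` if all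
`f i ≫ g` lift to morphisms `Y i ⟶ Z`, and any `g' : X ⟶ G Z'` with the same property is
`g ≫ G k` for a unique `k : Z ⟶ Z'`. -/
def IsSemifinal (G : A ⥤ B) {I : Type w} {X : B} {Y : I → A} (f : ∀ i, G.obj (Y i) ⟶ X)
    {Z : A} (g : X ⟶ G.obj Z) : Prop :=
  (∀ i, ∃ h : Y i ⟶ Z, G.map h = f i ≫ g) ∧
    ∀ (Z' : A) (g' : X ⟶ G.obj Z'), (∀ i, ∃ h : Y i ⟶ Z', G.map h = f i ≫ g') →
      ∃! k : Z ⟶ Z', g ≫ G.map k = g'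

/-- A functor is solid (or semi-topological) if it is faithful and every structured sink, of any
size, has a semifinal arrow. -/
def IsSolidFunctor (G : A ⥤ B) : Prop :=
  G.Faithful ∧ ∀ (I : Type w) (X : B) (Y : I → A) (f : ∀ i, G.obj (Y i) ⟶ X),
    ∃ (Z : A) (g : X ⟶ G.obj Z), IsSemifinal G f g

end

/-!
The congruence biframe `C L` is the free strictly zero-dimensional biframe on the frame `L`, and
the argument rests on two consequences of its universal property.

First, `χ : C M₁ → M` is surjective, because its image contains `M₁` and all complements of
elements of `M₁`, which together generate `M` (`chi_surjective`). So a strictly zero-dimensional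
biframe is recovered as the quotient of `C M₁` by `ker χ`, and morphisms are determined by their
restrictions to first parts (`Str0DBiFrm.hom_ext`). Second, a biframe homomorphism `C L / C → M` is
the same thing as a frame homomorphism `f : L → M₁` such that `C² f` sends `C` below `ker χ`
(`liftHom`, `toFirst_liftHom`). Hence `(L, C) ↦ C L / C` is left adjoint to `M ↦ (M₁, ker χ)`, with
invertible counit (`quotAdjunction`).

An object `(L, C)` is in the image of the embedding when the surjection `L → (C L / C)₁` is
injective. Every nonzero congruence on `L` lies above a nonzero one of the form `∇_b ∧ Δ_a`, so this
happens precisely when `C` is dense (`FrameCon.isDense_iff_closed`). The largest dense congruence is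
itself dense, as dense congruences lie below the kernel of double negation, so it is equivalent
that `C` be at most the largest dense congruence.

The fibres of the projection `∫ C² ⥤ Frm` are complete lattices. Initial lifts are therefore meets
of preimages (`initialLift`), and final lifts are joins of images (`finalCon`). Reflecting a final
lift yields semifinal arrows for the first part functor, and the formulas for limits and colimits
are those of `∫ C²` followed by `(L, C) ↦ C L / C` (`quotCoconeIsColimit`, `quotConeIsLimit`). For
limits of arbitrary size one needs that the projections of a limit of frames are jointly injective,
which holds since the free frame on one generator represents the underlying set
(`Frm.isLimit_ext`).

It remains to see that frames have limits and colimits. Limits are frames of compatible families.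
Colimits are presented by generators and relations, as quotients of free frames; the free frame on
a set is the frame of lower sets of the free meet-semilattice on it.
-/

/-! ### Subframes and dense congruences -/

namespace IsSubframe

variable {L : Type u} {M : Type u} [Frame L] [Frame M] {S : Set M} (hS : IsSubframe S)

/-- A frame homomorphism with values in a subframe, as a homomorphism to the subframe. -/
def codRestrict (g : FrameHom L M) (h : ∀ a, g a ∈ S) : letI := hS.frame; FrameHom L S :=
  letI := hS.frame
  { toFun := fun a => ⟨g a, h a⟩
    map_inf' := fun a b => Subtype.ext (map_inf g a b)
    map_top' := Subtype.ext (map_top g)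
    map_sSup' := fun T => Subtype.ext (by
      change g (sSup T) = sSup (Subtype.val '' _)
      rw [map_sSup, Set.image_image]) }

end IsSubframe

namespace FrameCon

variable {L : Type u} {M : Type u} {N : Type u} [Frame L] [Frame M] [Frame N]

/-- The factorization of `g` through a surjective frame homomorphism `h` with smaller kernel. -/
noncomputable def descend (h : FrameHom L M) (hs : Function.Surjective h) (g : FrameHom L N)
    (hg : ∀ a b, h a = h b → g a = g b) : FrameHom M N :=
  have key : ∀ a, g (Function.surjInv hs (h a)) = g a := fun a =>
    hg _ _ (Function.surjInv_eq hs (h a))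
  { toFun := fun x => g (Function.surjInv hs x)
    map_inf' := fun x y => by
      obtain ⟨a, rfl⟩ := hs x
      obtain ⟨b, rfl⟩ := hs y
      rw [← map_inf h, key, key, key, map_inf]
    map_top' := by rw [← map_top h, key, map_top]
    map_sSup' := fun T => by
      obtain ⟨S, rfl⟩ := Set.image_surjective.2 hs T
      rw [← map_sSup h, key, map_sSup, Set.image_image]
      exact congrArg sSup (Set.image_congr fun a _ => (key a).symm) }

theorem descend_apply (h : FrameHom L M) (hs : Function.Surjective h) (g : FrameHom L N)
    (hg : ∀ a b, h a = h b → g a = g b) (a : L) : descend h hs g hg (h a) = g a :=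
  hg _ _ (Function.surjInv_eq hs (h a))

/-- The kernel of the double negation nucleus contains every dense congruence. -/
theorem IsDense.compl_eq {C : FrameCon L} (hC : C.IsDense) {a b : L} (h : C.r a b) : aᶜ = bᶜ := by
  have key : ∀ a b : L, C.r a b → bᶜ ≤ aᶜ := fun a b h => by
    refine le_compl_iff_disjoint_right.2 (disjoint_iff.2 (isDense_iff.1 hC _ ?_))
    have h1 := C.inf (C.refl bᶜ) h
    rwa [compl_inf_self] at h1
  exact le_antisymm (key b a (C.symm h)) (key a b h)

theorem isDense_largestDense (L : Type u) [Frame L] : (largestDense L).IsDense := by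
  have key : largestDense L ≤ ofNucleus
      { toFun := fun a : L => aᶜᶜ
        map_inf' := compl_compl_inf_distrib
        idempotent' := fun a => by simp
        le_apply' := fun a => le_compl_compl } :=
    sSup_le fun C hC => le_def.2 fun a b h => congrArg compl (IsDense.compl_eq hC h)
  refine isDense_iff.2 fun a ha => ?_
  have h1 : aᶜᶜ = (⊥ : L)ᶜᶜ := le_def.1 key _ _ ha
  rw [compl_bot, compl_top] at h1
  exact le_bot_iff.1 (le_compl_compl.trans h1.le)

theorem le_largestDense_iff {C : FrameCon L} : C ≤ largestDense L ↔ C.IsDense := by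
  refine ⟨fun h => isDense_iff.2 fun a ha => ?_, fun h => le_sSup h⟩
  exact isDense_iff.1 (isDense_largestDense L) a (le_def.1 h _ _ ha)

/-- A congruence on `C L` is dense exactly when `L → C L → C L / C` is injective: every nonzero
congruence on `L` contains a nonzero one of the form `∇_b ∧ Δ_a`. -/
theorem isDense_iff_closed {C : FrameCon (FrameCon L)} :
    C.IsDense ↔ ∀ a b : L, C.r (closed a) (closed b) → a = b := by
  rw [isDense_iff]
  constructor
  · intro h
    have key : ∀ a b : L, C.r (closed a) (closed b) → b ≤ a := fun a b hab => by
      -- Meeting with `Δ_a` turns `∇_a ~ ∇_b` into `∇_b ∧ Δ_a ~ 0`, so that `∇_b ≤ ∇_a`.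
      have h1 := C.symm (C.inf hab (C.refl (opn a)))
      rw [(isCompl_closed_opn a).inf_eq_bot] at h1
      have h2 : closed b ≤ closed a :=
        (isCompl_closed_opn a).symm.le_sup_right_iff_inf_left_le.2 (h _ h1).le |>.trans (by simp)
      rw [closed_le, closed_r, bot_sup_eq] at h2
      exact h2 ▸ le_sup_left
    exact fun a b hab => le_antisymm (key b a (C.symm hab)) (key a b hab)
  · intro h E hE
    have key : ∀ a b : L, E.r a b → b ≤ a := fun a b hab => by
      have h1 : closed b ⊓ opn a ≤ E := by
        conv_rhs => rw [eq_iSup E]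
        exact le_iSup (fun p : {p : L × L // E.r p.1 p.2} => closed p.1.2 ⊓ opn p.1.1) ⟨(a, b), hab⟩
      have h2 := C.inf (C.refl (closed b ⊓ opn a)) hE
      rw [inf_eq_left.2 h1, inf_bot_eq] at h2
      -- Joining `∇_b ∧ Δ_a ~ 0` with `∇_a` gives `∇_(b ∨ a) ~ ∇_a`.
      have h3 := C.sup h2 (C.refl (closed a))
      rw [sup_inf_right, sup_comm (opn a), (isCompl_closed_opn a).sup_eq_top, inf_top_eq,
        bot_sup_eq] at h3
      have h4 : closed b ⊔ closed a = closed (b ⊔ a) := (map_sup (nabla L) b a).symm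
      exact (h _ _ (h4 ▸ h3)) ▸ le_sup_left
    exact le_bot_iff.1 (le_def.2 fun a b hab =>
      bot_r.2 (le_antisymm (key b a (E.symm hab)) (key a b hab)))

end FrameCon

/-! ### The congruential coreflection -/

/-- The image of `χ` is a subframe which contains `M₁` and the complements of its elements, and
these generate `M`. -/
theorem chi_surjective (M : Str0DBiFrm.{u}) : Function.Surjective (chi M) := by
  have h1 : IsSubframe (L := M.obj.total) (Set.range (chi M)) := by
    have := IsSubframe.univ.image (chi M)
    rwa [Set.image_univ] at this
  have h2 : M.obj.first ∪ M.obj.second ⊆ Set.range (chi M) := by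
    rw [← M.property.generate_second]
    refine Set.union_subset (fun a ha => ⟨_, chi_closed M ⟨a, ha⟩⟩) (subframeClosure_subset h1 ?_)
    rintro c ⟨a, ha, hc⟩
    let a' : firstPartFunctor.obj M := ⟨a, ha⟩
    have h := (FrameCon.isCompl_closed_opn a').map (chi M)
    rw [chi_closed] at h
    exact ⟨FrameCon.opn a', h.right_unique hc⟩
  have h3 := subframeClosure_subset h1 h2
  rw [M.obj.generate] at h3
  exact fun x => h3 trivial

theorem chi_opn_mem (M : Str0DBiFrm.{u}) (a : firstPartFunctor.obj M) :
    chi M (FrameCon.opn a) ∈ M.obj.second := by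
  obtain ⟨c, hc, h⟩ := M.property.exists_compl _ a.2
  have h' := (FrameCon.isCompl_closed_opn a).map (chi M)
  rw [chi_closed] at h'
  exact h'.right_unique h ▸ hc

/-- Morphisms of strictly zero-dimensional biframes are determined by their first parts. -/
theorem Str0DBiFrm.hom_ext {M N : Str0DBiFrm.{u}} {f g : M ⟶ N}
    (h : firstPartFunctor.map f = firstPartFunctor.map g) : f = g := by
  apply ObjectProperty.hom_ext
  apply BiFrm.Hom.ext
  refine DFunLike.ext _ _ fun x => ?_
  obtain ⟨θ, rfl⟩ := chi_surjective M x
  rw [← chi_naturality f, ← chi_naturality g, h]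

instance : firstPartFunctor.{u}.Faithful := ⟨Str0DBiFrm.hom_ext⟩

/-! ### The reflection of `∫ C²` onto strictly zero-dimensional biframes -/

/-- The frame homomorphism underlying `liftHom`. -/
noncomputable def liftFrameHom {X : IntCongSq.{u}} {M : Str0DBiFrm.{u}}
    (f : X.base ⟶ firstPartFunctor.obj M)
    (h : FrameCon.map (FrameCon.map f.hom) X.con ≤ FrameCon.ker (chi M)) :
    FrameHom (quotFunctor.obj X).obj.total M.obj.total :=
  FrameCon.descend (quotProj X) X.con.quotHom_surjective ((chi M).comp (FrameCon.map f.hom))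
    fun θ θ' hθ => FrameCon.ker_r.1
      (FrameCon.le_def.1 (FrameCon.map_le.1 h) θ θ' (FrameCon.quotHom_eq.1 hθ))

theorem liftFrameHom_quotProj {X : IntCongSq.{u}} {M : Str0DBiFrm.{u}}
    (f : X.base ⟶ firstPartFunctor.obj M)
    (h : FrameCon.map (FrameCon.map f.hom) X.con ≤ FrameCon.ker (chi M)) (θ : FrameCon X.base) :
    liftFrameHom f h (quotProj X θ) = chi M (FrameCon.map f.hom θ) :=
  FrameCon.descend_apply _ _ _ _ _

/-- The transpose `C L / C → M` of a frame homomorphism `f : L → M₁` for which `C² f` sends `C`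
below the kernel of `χ : C M₁ → M`. -/
noncomputable def liftHom {X : IntCongSq.{u}} {M : Str0DBiFrm.{u}}
    (f : X.base ⟶ firstPartFunctor.obj M)
    (h : FrameCon.map (FrameCon.map f.hom) X.con ≤ FrameCon.ker (chi M)) :
    quotFunctor.obj X ⟶ M :=
  ObjectProperty.homMk
    { toFrameHom := liftFrameHom f h
      map_first := by
        rintro _ ⟨_, ⟨a, rfl⟩, rfl⟩
        change liftFrameHom f h (quotProj X (FrameCon.closed a)) ∈ _
        rw [liftFrameHom_quotProj, FrameCon.map_closed, chi_closed]
        exact (f.hom a).2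
      map_second := by
        rintro _ ⟨θ, hθ, rfl⟩
        refine Set.mem_of_eq_of_mem (liftFrameHom_quotProj f h θ) ?_
        refine subframeClosure_subset
          (M.obj.isSubframe_second.preimage ((chi M).comp (FrameCon.map f.hom))) ?_ hθ
        rintro _ ⟨a, rfl⟩
        change chi M (FrameCon.map f.hom (FrameCon.opn a)) ∈ M.obj.second
        rw [FrameCon.map_opn]
        exact chi_opn_mem M _ }

theorem liftHom_quotProj {X : IntCongSq.{u}} {M : Str0DBiFrm.{u}}
    (f : X.base ⟶ firstPartFunctor.obj M)
    (h : FrameCon.map (FrameCon.map f.hom) X.con ≤ FrameCon.ker (chi M)) (θ : FrameCon X.base) :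
    (liftHom f h).hom.toFrameHom (quotProj X θ) = chi M (FrameCon.map f.hom θ) :=
  liftFrameHom_quotProj f h θ

/-- The frame homomorphism `a ↦ [∇_a]` from `L` to the first part of `C L / C`. -/
def toFirst (X : IntCongSq.{u}) : X.base ⟶ firstPartFunctor.obj (quotFunctor.obj X) :=
  Frm.ofHom ((quotFunctor.obj X).obj.isSubframe_first.codRestrict
    ((quotProj X).comp (FrameCon.nabla X.base)) fun a => ⟨_, ⟨a, rfl⟩, rfl⟩)

theorem toFirst_surjective (X : IntCongSq.{u}) : Function.Surjective (toFirst X) := by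
  rintro ⟨_, _, ⟨a, rfl⟩, rfl⟩
  exact ⟨a, rfl⟩

theorem chi_map_toFirst (X : IntCongSq.{u}) (θ : FrameCon X.base) :
    chi (quotFunctor.obj X) (FrameCon.map (toFirst X).hom θ) = quotProj X θ := by
  have : (chi (quotFunctor.obj X)).comp (FrameCon.map (toFirst X).hom) = quotProj X :=
    FrameCon.hom_ext fun a => by
      change chi _ (FrameCon.map (toFirst X).hom (FrameCon.closed a)) = _
      rw [FrameCon.map_closed, chi_closed]
      rfl
  exact DFunLike.congr_fun this θ

theorem map_toFirst_con_le (X : IntCongSq.{u}) :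
    FrameCon.map (FrameCon.map (toFirst X).hom) X.con ≤ FrameCon.ker (chi (quotFunctor.obj X)) :=
  FrameCon.map_le.2 <| FrameCon.le_def.2 fun θ θ' h => FrameCon.ker_r.2 <| by
    rw [chi_map_toFirst, chi_map_toFirst]
    exact FrameCon.quotHom_eq.2 h

/-- Morphisms out of `C L / C` are determined by their values at the classes `[∇_a]`. -/
theorem quotFunctor_hom_ext {X : IntCongSq.{u}} {M : Str0DBiFrm.{u}} {f g : quotFunctor.obj X ⟶ M}
    (h : toFirst X ≫ firstPartFunctor.map f = toFirst X ≫ firstPartFunctor.map g) : f = g := by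
  refine Str0DBiFrm.hom_ext (Frm.ext fun x => ?_)
  obtain ⟨a, rfl⟩ := toFirst_surjective X x
  exact ConcreteCategory.congr_hom h a

theorem toFirst_liftHom {X : IntCongSq.{u}} {M : Str0DBiFrm.{u}}
    (f : X.base ⟶ firstPartFunctor.obj M)
    (h : FrameCon.map (FrameCon.map f.hom) X.con ≤ FrameCon.ker (chi M)) :
    toFirst X ≫ firstPartFunctor.map (liftHom f h) = f := by
  refine Frm.ext fun a => Subtype.ext ?_
  change (liftHom f h).hom.toFrameHom (quotProj X (FrameCon.closed a)) = _
  rw [liftHom_quotProj, FrameCon.map_closed, chi_closed]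
  rfl

theorem toFirst_naturality {X Y : IntCongSq.{u}} (f : X ⟶ Y) :
    toFirst X ≫ firstPartFunctor.map (quotFunctor.map f) = f.base ≫ toFirst Y := by
  refine Frm.ext fun a => Subtype.ext ?_
  change quotProj Y (FrameCon.map f.base.hom (FrameCon.closed a)) = _
  rw [FrameCon.map_closed]
  rfl

theorem map_toFirst_comp_con_le {X : IntCongSq.{u}} {M : Str0DBiFrm.{u}}
    (g : quotFunctor.obj X ⟶ M) :
    FrameCon.map (FrameCon.map (toFirst X ≫ firstPartFunctor.map g).hom) X.con ≤
      FrameCon.ker (chi M) :=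
  IntCongSq.map_con_le (X := X) (Y := kerEmbedding.obj M)
    (IntCongSq.homMk (Y := kerEmbedding.obj (quotFunctor.obj X)) (toFirst X)
      (map_toFirst_con_le X) ≫ kerEmbedding.map g)

/-- The quotient functor `(L, C) ↦ C L / C` is left adjoint to the embedding of strictly
zero-dimensional biframes in `∫ C²`. -/
noncomputable def quotAdjunction : quotFunctor.{u} ⊣ kerEmbedding.{u} :=
  Adjunction.mkOfHomEquiv
    { homEquiv := fun X M =>
        { toFun := fun g => IntCongSq.homMk (Y := kerEmbedding.obj M)
            (toFirst X ≫ firstPartFunctor.map g) (map_toFirst_comp_con_le g)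
          invFun := fun f => liftHom f.base (IntCongSq.map_con_le f)
          left_inv := fun _ => quotFunctor_hom_ext (toFirst_liftHom _ _)
          right_inv := fun _ => IntCongSq.hom_ext (toFirst_liftHom _ _) }
      homEquiv_naturality_left_symm := fun {X' X M} f g => quotFunctor_hom_ext <| by
        rw [Functor.map_comp, ← Category.assoc, toFirst_naturality, Category.assoc]
        exact (toFirst_liftHom (M := M) (f ≫ g).base (IntCongSq.map_con_le (f ≫ g))).trans
          (congrArg (f.base ≫ ·) (toFirst_liftHom (M := M) g.base (IntCongSq.map_con_le g)).symm)
      homEquiv_naturality_right := fun {X M M'} f g => IntCongSq.hom_ext <| by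
        change toFirst X ≫ firstPartFunctor.map (f ≫ g) =
          (toFirst X ≫ firstPartFunctor.map f) ≫ firstPartFunctor.map g
        rw [Functor.map_comp, Category.assoc] }

theorem counit_quotProj (M : Str0DBiFrm.{u}) (θ : FrameCon (firstPartFunctor.obj M)) :
    (quotAdjunction.counit.app M).hom.toFrameHom (quotProj (kerEmbedding.obj M) θ) = chi M θ :=
  (liftHom_quotProj _ _ _).trans (congrArg (chi M) (FrameCon.map_id θ))

/-- The frame homomorphism underlying `counitInv`. -/
noncomputable def counitInvFrameHom (M : Str0DBiFrm.{u}) :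
    FrameHom M.obj.total (quotFunctor.obj (kerEmbedding.obj M)).obj.total :=
  FrameCon.descend (chi M) (chi_surjective M) (quotProj (kerEmbedding.obj M)) fun _ _ h =>
    FrameCon.quotHom_eq.2 (FrameCon.ker_r.2 h)

theorem counitInvFrameHom_chi (M : Str0DBiFrm.{u}) (θ : FrameCon (firstPartFunctor.obj M)) :
    counitInvFrameHom M (chi M θ) = quotProj (kerEmbedding.obj M) θ :=
  FrameCon.descend_apply _ _ _ _ _

/-- The inverse of the counit: since `χ` is surjective, `M` is the quotient of `C M₁` by its
kernel. -/
noncomputable def counitInv (M : Str0DBiFrm.{u}) : M ⟶ quotFunctor.obj (kerEmbedding.obj M) :=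
  ObjectProperty.homMk
    { toFrameHom := counitInvFrameHom M
      map_first := fun a ha => by
        have h := chi_closed M ⟨a, ha⟩
        change chi M _ = a at h
        rw [← h, counitInvFrameHom_chi]
        exact ⟨_, ⟨_, rfl⟩, rfl⟩
      map_second := fun c hc => by
        rw [← M.property.generate_second] at hc
        refine subframeClosure_subset ((quotFunctor.obj
          (kerEmbedding.obj M)).obj.isSubframe_second.preimage (counitInvFrameHom M)) ?_ hc
        rintro c ⟨a, ha, hac⟩
        let a' : firstPartFunctor.obj M := ⟨a, ha⟩
        have h := (FrameCon.isCompl_closed_opn a').map (chi M)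
        rw [chi_closed] at h
        rw [Set.mem_preimage, ← h.right_unique hac, counitInvFrameHom_chi]
        exact ⟨_, subset_subframeClosure _ ⟨_, rfl⟩, rfl⟩ }

theorem counitInv_chi (M : Str0DBiFrm.{u}) (θ : FrameCon (firstPartFunctor.obj M)) :
    (counitInv M).hom.toFrameHom (chi M θ) = quotProj (kerEmbedding.obj M) θ :=
  counitInvFrameHom_chi M θ

/-- The counit is an isomorphism, so the right adjoint is full and faithful. -/
instance : IsIso quotAdjunction.{u}.counit := by
  have : ∀ M, IsIso (quotAdjunction.{u}.counit.app M) := fun M => by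
    refine ⟨counitInv M, ?_, ?_⟩ <;> apply ObjectProperty.hom_ext <;> apply BiFrm.Hom.ext <;>
      refine DFunLike.ext _ _ fun x => ?_
    · obtain ⟨θ, rfl⟩ := FrameCon.quotHom_surjective _ x
      exact (congrArg (counitInv M).hom.toFrameHom (counit_quotProj M θ)).trans (counitInv_chi M θ)
    · obtain ⟨θ, rfl⟩ := chi_surjective M x
      exact (congrArg (quotAdjunction.counit.app M).hom.toFrameHom (counitInv_chi M θ)).trans
        (counit_quotProj M θ)
  exact NatIso.isIso_of_isIso_app _

/-- Strictly zero-dimensional biframes form a reflective subcategory of `∫ C²`. -/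
noncomputable instance : Reflective kerEmbedding.{u} :=
  { quotAdjunction.fullyFaithfulROfIsIsoCounit.full,
    quotAdjunction.fullyFaithfulROfIsIsoCounit.faithful with
    L := quotFunctor
    adj := quotAdjunction }

/-! ### The essential image -/

/-- The unit `L → (C L / C)₁` is injective when `C` is dense. -/
theorem toFirst_injective {X : IntCongSq.{u}} (h : X.con.IsDense) :
    Function.Injective (toFirst X) := fun a b hab =>
  FrameCon.isDense_iff_closed.1 h a b (FrameCon.quotHom_eq.1 (congrArg Subtype.val hab))

theorem isDense_ker_chi (M : Str0DBiFrm.{u}) : (FrameCon.ker (chi M)).IsDense :=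
  FrameCon.isDense_iff_closed.2 fun a b h => Subtype.ext <| by
    have h' := FrameCon.ker_r.1 h
    rwa [chi_closed, chi_closed] at h'

/-- Density says that `L → (C L / C)₁` is injective; being always surjective, it then identifies
`(L, C)` with the image of the biframe `C L / C`. -/
theorem essImage_kerEmbedding_iff (X : IntCongSq.{u}) :
    kerEmbedding.{u}.essImage X ↔ X.con ≤ FrameCon.largestDense (FrameCon X.base) := by
  rw [FrameCon.le_largestDense_iff]
  constructor
  · rintro ⟨M, ⟨e⟩⟩
    refine FrameCon.isDense_iff_closed.2 fun a b h => ?_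
    have h1 := FrameCon.le_def.1 (FrameCon.map_le.1 (IntCongSq.map_con_le e.inv)) _ _ h
    rw [FrameCon.comap_r, FrameCon.map_closed, FrameCon.map_closed] at h1
    have h2 := FrameCon.isDense_iff_closed.1 (isDense_ker_chi M) _ _ h1
    have h3 : e.inv.base ≫ e.hom.base = 𝟙 X.base := congrArg Grothendieck.Hom.base e.inv_hom_id
    calc a = (e.inv.base ≫ e.hom.base) a := by rw [h3]; rfl
      _ = (e.inv.base ≫ e.hom.base) b := congrArg e.hom.base.hom h2
      _ = b := by rw [h3]; rfl
  · intro h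
    have hbij : Function.Bijective (toFirst X) := ⟨toFirst_injective h, toFirst_surjective X⟩
    let Q := quotFunctor.obj X
    let g : firstPartFunctor.obj Q ⟶ X.base := Frm.ofHom <|
      FrameCon.descend (toFirst X).hom hbij.2 (FrameHom.id X.base) fun _ _ hab => hbij.1 hab
    have hga : ∀ a, g (toFirst X a) = a := fun a =>
      FrameCon.descend_apply (toFirst X).hom hbij.2 (FrameHom.id X.base)
        (fun _ _ hab => hbij.1 hab) a
    have hg : toFirst X ≫ g = 𝟙 _ := Frm.ext hga
    have hg' : g ≫ toFirst X = 𝟙 _ := Frm.ext fun x => by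
      obtain ⟨a, rfl⟩ := hbij.2 x
      exact congrArg (toFirst X).hom (hga a)
    have key : ∀ θ, quotProj X (FrameCon.map g.hom θ) = chi Q θ := fun θ => by
      rw [← chi_map_toFirst, ← FrameCon.map_comp, ← Frm.hom_comp, hg']
      exact congrArg (chi Q) (FrameCon.map_id θ)
    refine ⟨Q, ⟨{
      hom := IntCongSq.homMk (X := kerEmbedding.obj Q) g (FrameCon.map_le.2 <|
        FrameCon.le_def.2 fun θ θ' hθ => FrameCon.comap_r.2 (FrameCon.quotHom_eq.1 ?_))
      inv := IntCongSq.homMk (Y := kerEmbedding.obj Q) (toFirst X) (map_toFirst_con_le X)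
      hom_inv_id := IntCongSq.hom_ext hg'
      inv_hom_id := IntCongSq.hom_ext hg }⟩⟩
    exact (key θ).trans ((FrameCon.ker_r.1 hθ).trans (key θ').symm)

/-! ### Free frames -/

/-- The free frame on a set `X`: lower sets of the free meet-semilattice on `X`, which consists of
the finite subsets of `X` (a subset stands for the meet of its elements) ordered by reverse
inclusion. -/
abbrev FreeFrame (X : Type u) : Type u := LowerSet (Finset X)ᵒᵈ

namespace FreeFrame

variable {X : Type u} {N : Type u} [Frame N]

/-- The generator of the free frame given by an element of `X`. -/
def gen (x : X) : FreeFrame X := LowerSet.Iic (OrderDual.toDual {x})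

/-- The function underlying `lift`: it sends a lower set of finite sets to the join of the
corresponding finite meets. -/
def liftFun (g : X → N) (U : FreeFrame X) : N :=
  ⨆ s : {s : Finset X // OrderDual.toDual s ∈ U}, s.1.inf g

theorem le_liftFun (g : X → N) {U : FreeFrame X} {s : Finset X} (h : OrderDual.toDual s ∈ U) :
    s.inf g ≤ liftFun g U :=
  le_iSup (fun s : {s : Finset X // OrderDual.toDual s ∈ U} => s.1.inf g) ⟨s, h⟩

/-- The universal property of the free frame: a function to a frame extends to a frame
homomorphism. -/
def lift (g : X → N) : FrameHom (FreeFrame X) N where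
  toFun := liftFun g
  map_inf' U V := by
    classical
    apply le_antisymm
    · exact iSup_le fun s => le_inf (le_liftFun g s.2.1) (le_liftFun g s.2.2)
    · change (⨆ p, _) ⊓ (⨆ q, _) ≤ _
      rw [iSup_inf_iSup]
      refine iSup_le fun p => ?_
      rw [← Finset.inf_union]
      exact le_liftFun g ⟨U.lower (OrderDual.toDual_le_toDual.2 Finset.subset_union_left) p.1.2,
        V.lower (OrderDual.toDual_le_toDual.2 Finset.subset_union_right) p.2.2⟩
  map_top' := top_le_iff.1 ((le_liftFun g (U := ⊤) (s := ∅) trivial).trans' (by simp))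
  map_sSup' T := by
    apply le_antisymm
    · refine iSup_le fun s => ?_
      obtain ⟨U, hU, hs⟩ := LowerSet.mem_sSup_iff.1 s.2
      exact (le_liftFun g hs).trans (le_sSup ⟨U, hU, rfl⟩)
    · refine sSup_le ?_
      rintro _ ⟨U, hU, rfl⟩
      exact iSup_le fun s => le_liftFun g (LowerSet.mem_sSup_iff.2 ⟨U, hU, s.2⟩)

theorem lift_gen (g : X → N) (x : X) : lift g (gen x) = g x := by
  apply le_antisymm
  · refine iSup_le fun s => Finset.inf_le ?_
    exact (OrderDual.toDual_le_toDual.1 (LowerSet.mem_Iic_iff.1 s.2)) (Finset.mem_singleton_self x)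
  · exact (le_liftFun g (U := gen x) (s := {x}) (LowerSet.mem_Iic_iff.2 le_rfl)).trans' (by simp)

theorem Iic_toDual (s : Finset X) : LowerSet.Iic (OrderDual.toDual s) = s.inf gen := by
  refine eq_of_forall_le_iff fun U => ?_
  rw [Finset.le_inf_iff]
  constructor
  · intro h x hx
    exact h.trans (LowerSet.Iic_le.2 (LowerSet.mem_Iic_iff.2
      (OrderDual.toDual_le_toDual.2 (Finset.singleton_subset_iff.2 hx))))
  · intro h t ht
    refine LowerSet.mem_Iic_iff.2 fun x hx => ?_
    exact (OrderDual.toDual_le_toDual.1 (LowerSet.mem_Iic_iff.1 (h x hx ht)))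
      (Finset.mem_singleton_self x)

theorem hom_ext {f g : FrameHom (FreeFrame X) N} (h : ∀ x, f (gen x) = g (gen x)) : f = g := by
  refine DFunLike.ext _ _ fun U => ?_
  have hU : U = ⨆ s ∈ U, LowerSet.Iic s := by
    ext s
    simp only [SetLike.mem_coe, LowerSet.mem_iSup_iff, LowerSet.mem_Iic_iff]
    exact ⟨fun hs => ⟨s, hs, le_rfl⟩, fun ⟨t, ht, hst⟩ => U.lower hst ht⟩
  have h' : ∀ s : (Finset X)ᵒᵈ, f (LowerSet.Iic s) = g (LowerSet.Iic s) := fun s => by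
    have h1 := Iic_toDual (OrderDual.ofDual s)
    rw [OrderDual.toDual_ofDual] at h1
    rw [h1, map_finset_inf, map_finset_inf]
    exact Finset.inf_congr rfl fun x _ => h x
  rw [hU]
  simp only [map_iSup, h']

end FreeFrame

/-! ### Limits and colimits of frames -/

namespace Frm

variable {J : Type u} [Category.{u} J] (F : J ⥤ Frm.{u})

/-- The families of elements compatible with the maps of the diagram. -/
def compatible : Set (∀ j, F.obj j) := {x | ∀ (j k : J) (f : j ⟶ k), F.map f (x j) = x k}

theorem isSubframe_compatible : IsSubframe (compatible F) where
  top_mem _ _ f := map_top (F.map f).hom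
  inf_mem x hx y hy _ _ f :=
    (map_inf (F.map f).hom _ _).trans (congrArg₂ (· ⊓ ·) (hx _ _ f) (hy _ _ f))
  sSup_mem T hT j k f := by
    change (F.map f).hom (sSup T j) = sSup T k
    rw [sSup_apply, sSup_apply, map_iSup]
    exact iSup_congr fun x => hT x.2 j k f

instance : Frame (compatible F) := (isSubframe_compatible F).frame

/-- The frame of compatible families, with its projections. -/
def limitCone : Limits.Cone F :=
  { pt := Frm.of (compatible F)
    π :=
      { app := fun j => Frm.ofHom
          { toFun := fun x => x.1 j
            map_inf' := fun _ _ => rfl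
            map_top' := rfl
            map_sSup' := fun T => by
              change (sSup (Subtype.val '' T) : ∀ j, F.obj j) j = _
              rw [sSup_apply, ← sSup_image' (f := fun x : ∀ j, F.obj j => x j), Set.image_image] }
        naturality := fun j k f => Frm.ext fun x => (x.2 j k f).symm } }

variable {F} in
/-- A leg of a cone as a frame homomorphism. -/
def coneHom (s : Limits.Cone F) (j : J) : FrameHom s.pt (F.obj j) := (s.π.app j).hom

variable {F} in
/-- A leg of a cocone as a frame homomorphism. -/
def coconeHom (s : Limits.Cocone F) (j : J) : FrameHom (F.obj j) s.pt := (s.ι.app j).hom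

/-- `limitCone` is a limit. -/
def limitConeIsLimit : Limits.IsLimit (limitCone F) where
  lift s := Frm.ofHom <| (isSubframe_compatible F).codRestrict
    { toFun := fun x j => coneHom s j x
      map_inf' := fun x y => funext fun j => map_inf (coneHom s j) x y
      map_top' := funext fun j => map_top (coneHom s j)
      map_sSup' := fun T => funext fun j => by
        rw [map_sSup, sSup_apply, ← sSup_image' (f := fun x : ∀ j, F.obj j => x j),
          Set.image_image] }
    fun x j k f => ConcreteCategory.congr_hom (s.w f) x
  fac s j := rfl
  uniq s m hm := Frm.ext fun x => Subtype.ext <| funext fun j =>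
    ConcreteCategory.congr_hom (hm j) x

instance : Limits.HasLimits Frm.{u} :=
  ⟨fun _ _ => ⟨fun F => ⟨⟨⟨limitCone F, limitConeIsLimit F⟩⟩⟩⟩⟩

/-- Relations on the free frame on all elements of the frames `F j` which make each `F j` a frame
and identify elements along the maps of the diagram. -/
inductive ColimitRel : FreeFrame (Σ j, F.obj j) → FreeFrame (Σ j, F.obj j) → Prop
  | top (j : J) : ColimitRel (FreeFrame.gen ⟨j, ⊤⟩) ⊤
  | inf (j : J) (a b : F.obj j) :
      ColimitRel (FreeFrame.gen ⟨j, a ⊓ b⟩) (FreeFrame.gen ⟨j, a⟩ ⊓ FreeFrame.gen ⟨j, b⟩)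
  | sSup (j : J) (T : Set (F.obj j)) :
      ColimitRel (FreeFrame.gen ⟨j, sSup T⟩) (sSup ((fun a => FreeFrame.gen ⟨j, a⟩) '' T))
  | map {j k : J} (f : j ⟶ k) (a : F.obj j) :
      ColimitRel (FreeFrame.gen ⟨k, F.map f a⟩) (FreeFrame.gen ⟨j, a⟩)

/-- The congruence presenting the colimit of `F`. -/
def colimitCon : FrameCon (FreeFrame (Σ j, F.obj j)) := FrameCon.gen (ColimitRel F)

theorem quotHom_colimitRel {x y : FreeFrame (Σ j, F.obj j)} (h : ColimitRel F x y) :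
    (colimitCon F).quotHom x = (colimitCon F).quotHom y :=
  FrameCon.quotHom_eq.2 (FrameCon.gen_le.1 le_rfl x y h)

/-- The frame presented by `ColimitRel F`, with the maps sending elements to generators. -/
def colimitCocone : Limits.Cocone F where
  pt := Frm.of (colimitCon F).Quot
  ι :=
    { app := fun j => Frm.ofHom
        { toFun := fun a => (colimitCon F).quotHom (FreeFrame.gen ⟨j, a⟩)
          map_inf' := fun a b =>
            (quotHom_colimitRel F (.inf j a b)).trans (map_inf (colimitCon F).quotHom _ _)
          map_top' := (quotHom_colimitRel F (.top j)).trans (map_top (colimitCon F).quotHom)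
          map_sSup' := fun T => (quotHom_colimitRel F (.sSup j T)).trans (by
            rw [map_sSup, Set.image_image]) }
      naturality := fun _ _ f => Frm.ext fun a => quotHom_colimitRel F (.map f a) }

/-- The values of a cocone on the generators of the colimit. -/
def cofan (s : Limits.Cocone F) (x : Σ j, F.obj j) : s.pt := coconeHom s x.1 x.2

/-- The frame homomorphism out of the colimit induced by a cocone. -/
noncomputable def colimitDesc (s : Limits.Cocone F) : FrameHom (colimitCon F).Quot s.pt :=
  FrameCon.descend (colimitCon F).quotHom (FrameCon.quotHom_surjective _)
    (FreeFrame.lift (cofan F s)) fun x y hxy => by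
      have h : colimitCon F ≤ FrameCon.ker (FreeFrame.lift (cofan F s)) := by
        refine FrameCon.gen_le.2 fun x y hxy => FrameCon.ker_r.2 ?_
        induction hxy with
        | top j =>
          rw [FreeFrame.lift_gen, map_top]
          exact map_top (coconeHom s j)
        | inf j a b =>
          rw [map_inf, FreeFrame.lift_gen, FreeFrame.lift_gen, FreeFrame.lift_gen]
          exact map_inf (coconeHom s j) a b
        | sSup j T =>
          rw [map_sSup, Set.image_image, FreeFrame.lift_gen]
          simp only [FreeFrame.lift_gen]
          exact map_sSup (coconeHom s j) T
        | map f a =>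
          rw [FreeFrame.lift_gen, FreeFrame.lift_gen]
          exact ConcreteCategory.congr_hom (s.w f) a
      exact FrameCon.ker_r.1 (FrameCon.le_def.1 h x y (FrameCon.quotHom_eq.1 hxy))

theorem colimitDesc_gen (s : Limits.Cocone F) (j : J) (a : F.obj j) :
    colimitDesc F s ((colimitCon F).quotHom (FreeFrame.gen ⟨j, a⟩)) = s.ι.app j a :=
  (FrameCon.descend_apply _ _ _ _ _).trans (FreeFrame.lift_gen (cofan F s) ⟨j, a⟩)

/-- `colimitCocone` is a colimit. -/
noncomputable def colimitCoconeIsColimit : Limits.IsColimit (colimitCocone F) where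
  desc s := Frm.ofHom (colimitDesc F s)
  fac s j := Frm.ext fun a => colimitDesc_gen F s j a
  uniq s m hm := by
    have h : m.hom.comp (colimitCon F).quotHom = (colimitDesc F s).comp (colimitCon F).quotHom :=
      FreeFrame.hom_ext fun ⟨j, a⟩ =>
        (ConcreteCategory.congr_hom (hm j) a).trans (colimitDesc_gen F s j a).symm
    refine Frm.ext fun x => ?_
    obtain ⟨y, rfl⟩ := (colimitCon F).quotHom_surjective x
    exact DFunLike.congr_fun h y

instance : Limits.HasColimits Frm.{u} :=
  ⟨fun _ _ => ⟨fun F => ⟨⟨⟨colimitCocone F, colimitCoconeIsColimit F⟩⟩⟩⟩⟩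

/-- The projections of a limit of frames, of any size, are jointly injective: elements of a frame
are homomorphisms from the free frame on one generator. -/
theorem isLimit_ext {I : Type w} [Category.{w'} I] {F : I ⥤ Frm.{u}} {c : Limits.Cone F}
    (hc : Limits.IsLimit c) {a b : c.pt} (h : ∀ i, c.π.app i a = c.π.app i b) : a = b := by
  let g : c.pt → (Frm.of (FreeFrame PUnit.{u + 1}) ⟶ c.pt) := fun a =>
    Frm.ofHom (FreeFrame.lift fun _ => a)
  have hg : ∀ a, g a (FreeFrame.gen PUnit.unit) = a := fun a => FreeFrame.lift_gen _ _
  have : g a = g b := hc.hom_ext fun i => Frm.hom_ext <| FreeFrame.hom_ext fun x =>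
    (congrArg (c.π.app i) (hg a)).trans ((h i).trans (congrArg (c.π.app i) (hg b)).symm)
  rw [← hg a, ← hg b, this]

end Frm

/-! ### Initial lifts and semifinal arrows -/

theorem FrameCon.map_map_comp {L M N : Frm.{u}} (f : L ⟶ M) (g : M ⟶ N)
    (C : FrameCon (FrameCon L)) :
    map (map (f ≫ g).hom) C = map (map g.hom) (map (map f.hom) C) :=
  ConcreteCategory.congr_hom ((congFunctor ⋙ congFunctor).map_comp f g) C

theorem FrameCon.map_map_id {L : Frm.{u}} (C : FrameCon (FrameCon L)) :
    map (map (𝟙 L : L ⟶ L).hom) C = C :=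
  ConcreteCategory.congr_hom ((congFunctor ⋙ congFunctor).map_id L) C

section

variable {I : Type w} {L : Frm.{u}} {Y : I → IntCongSq.{u}}

/-- The largest congruence on `C L` which makes all `f i : L ⟶ (Y i).base` morphisms. -/
def initialCon (f : ∀ i, L ⟶ (Y i).base) : FrameCon (FrameCon L) :=
  ⨅ i, FrameCon.comap (FrameCon.map (f i).hom) (Y i).con

theorem map_le_initialCon_iff {f : ∀ i, L ⟶ (Y i).base} {K : Frm.{u}} (h : K ⟶ L)
    {C : FrameCon (FrameCon K)} :
    FrameCon.map (FrameCon.map h.hom) C ≤ initialCon f ↔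
      ∀ i, FrameCon.map (FrameCon.map (h ≫ f i).hom) C ≤ (Y i).con := by
  simp only [initialCon, le_iInf_iff, FrameCon.map_map_comp]
  exact forall_congr' fun i => FrameCon.map_le.symm

theorem le_initialCon_iff {f : ∀ i, L ⟶ (Y i).base} {C : FrameCon (FrameCon L)} :
    C ≤ initialCon f ↔ ∀ i, FrameCon.map (FrameCon.map (f i).hom) C ≤ (Y i).con := by
  simpa only [FrameCon.map_map_id, Category.id_comp] using
    map_le_initialCon_iff (f := f) (𝟙 L) (C := C)

/-- The initial lift of a structured source. -/
def initialLift (f : ∀ i, L ⟶ (Y i).base) : InitialLift (Grothendieck.forget congSqCat.{u}) f where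
  obj := IntCongSq.mk L (initialCon f)
  obj_eq := rfl
  map i := IntCongSq.homMk (f i) (le_initialCon_iff.1 le_rfl i)
  map_eq i := (Category.id_comp _).symm
  isInitial Z n h hn := by
    refine ⟨IntCongSq.homMk h ((map_le_initialCon_iff h).2 fun i => ?_), ⟨rfl, fun i =>
      IntCongSq.hom_ext (hn i)⟩, fun k hk => IntCongSq.hom_ext hk.1⟩
    have h1 := IntCongSq.map_con_le (n i)
    have h2 : (n i).base = h ≫ f i := hn i
    rwa [h2] at h1

/-- Initial lifts are unique on the nose because the fibres of `∫ C²` are partial orders. -/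
theorem InitialLift.eq_initialLift (f : ∀ i, L ⟶ (Y i).base)
    (l : InitialLift (Grothendieck.forget congSqCat.{u}) f) : l = initialLift f := by
  obtain ⟨⟨K, C⟩, hK, m, hm, hinit⟩ := l
  obtain rfl : K = L := hK
  have hm' : ∀ i, (m i).base = f i := fun i => (hm i).trans (Category.id_comp _)
  have hC : (C : FrameCon (FrameCon K)) = initialCon f := by
    refine le_antisymm (α := FrameCon (FrameCon K)) ?_ ?_
    · refine le_initialCon_iff.2 fun i => ?_
      have := IntCongSq.map_con_le (m i)
      rwa [hm'] at this
    -- Initiality of the given lift makes the identity of `K` a morphism from `initialLift f`.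
    · obtain ⟨k, ⟨hk, -⟩, -⟩ := hinit (initialLift f).obj (initialLift f).map (𝟙 K) fun i =>
        ((hm' i).symm.trans (Category.id_comp _).symm)
      have := IntCongSq.map_con_le k
      have hk' : k.base = 𝟙 K := hk
      rw [hk'] at this
      exact (FrameCon.map_map_id _).ge.trans this
  obtain rfl : C = (initialCon f : FrameCon (FrameCon K)) := hC
  obtain rfl : m = (initialLift f).map := funext fun i => IntCongSq.hom_ext (hm' i)
  rfl

end

theorem isTopologicalFunctor_forget :
    IsTopologicalFunctor.{w} (Grothendieck.forget congSqCat.{u}) := fun _ _ _ f =>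
  ⟨{ default := initialLift f, uniq := InitialLift.eq_initialLift f }⟩

/-- A frame homomorphism between first parts extends to a biframe homomorphism exactly when it is
a morphism of `∫ C²`. -/
theorem exists_firstPartFunctor_map_iff {M N : Str0DBiFrm.{u}}
    (g : firstPartFunctor.obj M ⟶ firstPartFunctor.obj N) :
    (∃ k : M ⟶ N, firstPartFunctor.map k = g) ↔
      FrameCon.map (FrameCon.map g.hom) (kerEmbedding.obj M).con ≤ FrameCon.ker (chi N) := by
  constructor
  · rintro ⟨k, rfl⟩
    exact IntCongSq.map_con_le (kerEmbedding.map k)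
  · intro h
    let g' : kerEmbedding.obj M ⟶ kerEmbedding.obj N :=
      IntCongSq.homMk (X := kerEmbedding.obj M) (Y := kerEmbedding.obj N) g h
    exact ⟨kerEmbedding.preimage g',
      congrArg Grothendieck.Hom.base (kerEmbedding.map_preimage g')⟩

section

variable {I : Type w} {L : Frm.{u}} {Y : I → Str0DBiFrm.{u}}

/-- The least congruence on `C L` which makes all `f i : (Y i)₁ ⟶ L` morphisms. -/
def finalCon (f : ∀ i, firstPartFunctor.obj (Y i) ⟶ L) : FrameCon (FrameCon L) :=
  ⨆ i, FrameCon.map (FrameCon.map (f i).hom) (kerEmbedding.obj (Y i)).con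

theorem map_finalCon_le_iff {f : ∀ i, firstPartFunctor.obj (Y i) ⟶ L} {K : Frm.{u}} (h : L ⟶ K)
    {C : FrameCon (FrameCon K)} :
    FrameCon.map (FrameCon.map h.hom) (finalCon f) ≤ C ↔
      ∀ i, FrameCon.map (FrameCon.map (f i ≫ h).hom) (kerEmbedding.obj (Y i)).con ≤ C := by
  rw [finalCon, map_iSup, iSup_le_iff]
  exact forall_congr' fun i => Iff.of_eq <| congrArg (· ≤ C)
    (FrameCon.map_map_comp (f i) h (kerEmbedding.obj (Y i)).con).symm

theorem finalCon_le_iff {f : ∀ i, firstPartFunctor.obj (Y i) ⟶ L} {C : FrameCon (FrameCon L)} :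
    finalCon f ≤ C ↔
      ∀ i, FrameCon.map (FrameCon.map (f i).hom) (kerEmbedding.obj (Y i)).con ≤ C :=
  iSup_le_iff

end

/-- A semifinal arrow is the composite of a final lift to `∫ C²` and the reflection. -/
theorem isSolidFunctor_firstPartFunctor : IsSolidFunctor.{w} firstPartFunctor.{u} := by
  refine ⟨inferInstance, fun I L Y f => ?_⟩
  let X := IntCongSq.mk L (finalCon f)
  refine ⟨quotFunctor.obj X, toFirst X, fun i => ?_, fun N g hg => ?_⟩
  · rw [exists_firstPartFunctor_map_iff]
    exact (map_finalCon_le_iff _).1 (map_toFirst_con_le X) i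
  · have h := (map_finalCon_le_iff g).2 fun i => (exists_firstPartFunctor_map_iff _).1 (hg i)
    exact ⟨liftHom (X := X) g h, toFirst_liftHom (X := X) g h, fun k hk =>
      quotFunctor_hom_ext (hk.trans (toFirst_liftHom (X := X) g h).symm)⟩

/-! ### Limits and colimits of strictly zero-dimensional biframes -/

theorem firstPartFunctor_map_counitInv (M : Str0DBiFrm.{u}) :
    firstPartFunctor.map (counitInv M) = toFirst (kerEmbedding.obj M) :=
  Frm.ext fun a => Subtype.ext <|
    (congrArg (counitInv M).hom.toFrameHom (chi_closed M a)).symm.trans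
      (counitInv_chi M (FrameCon.closed a))

/-- The morphism `M → C L / C` given by a morphism `(M₁, ker χ) → (L, C)` of `∫ C²`. -/
noncomputable def toQuot {M : Str0DBiFrm.{u}} {X : IntCongSq.{u}} (f : kerEmbedding.obj M ⟶ X) :
    M ⟶ quotFunctor.obj X :=
  counitInv M ≫ quotFunctor.map f

theorem firstPartFunctor_map_toQuot {M : Str0DBiFrm.{u}} {X : IntCongSq.{u}}
    (f : kerEmbedding.obj M ⟶ X) :
    firstPartFunctor.map (toQuot f) = f.base ≫ toFirst X := by
  rw [toQuot, Functor.map_comp, firstPartFunctor_map_counitInv]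
  exact toFirst_naturality f

theorem toQuot_chi {M : Str0DBiFrm.{u}} {X : IntCongSq.{u}} (f : kerEmbedding.obj M ⟶ X)
    (θ : FrameCon (firstPartFunctor.obj M)) :
    (toQuot f).hom.toFrameHom (chi M θ) = quotProj X (FrameCon.map f.base.hom θ) :=
  congrArg (quotFunctor.map f).hom.toFrameHom (counitInv_chi M θ)

theorem eq_liftHom {X : IntCongSq.{u}} {M : Str0DBiFrm.{u}} {f : X.base ⟶ firstPartFunctor.obj M}
    (h : FrameCon.map (FrameCon.map f.hom) X.con ≤ FrameCon.ker (chi M))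
    {m : quotFunctor.obj X ⟶ M} (hm : toFirst X ≫ firstPartFunctor.map m = f) : m = liftHom f h :=
  quotFunctor_hom_ext (hm.trans (toFirst_liftHom f h).symm)

theorem liftHom_comp {X : IntCongSq.{u}} {M N : Str0DBiFrm.{u}}
    {f : X.base ⟶ firstPartFunctor.obj M} {g : X.base ⟶ firstPartFunctor.obj N}
    (hf : FrameCon.map (FrameCon.map f.hom) X.con ≤ FrameCon.ker (chi M))
    (hg : FrameCon.map (FrameCon.map g.hom) X.con ≤ FrameCon.ker (chi N)) {k : M ⟶ N}
    (hk : f ≫ firstPartFunctor.map k = g) : liftHom f hf ≫ k = liftHom g hg :=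
  eq_liftHom hg (by rw [Functor.map_comp, ← Category.assoc, toFirst_liftHom, hk])

theorem comp_toQuot {M N : Str0DBiFrm.{u}} {X : IntCongSq.{u}} {k : M ⟶ N}
    {f : kerEmbedding.obj N ⟶ X} {g : kerEmbedding.obj M ⟶ X}
    (h : firstPartFunctor.map k ≫ f.base = g.base) : k ≫ toQuot f = toQuot g :=
  Str0DBiFrm.hom_ext <| by
    rw [Functor.map_comp, firstPartFunctor_map_toQuot, firstPartFunctor_map_toQuot, ← h]
    exact (Category.assoc _ _ _).symm

theorem firstPartFunctor_map_toQuot_comp {M N : Str0DBiFrm.{u}} {X : IntCongSq.{u}}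
    (g : kerEmbedding.obj M ⟶ X) (m : quotFunctor.obj X ⟶ N) :
    firstPartFunctor.map (toQuot g ≫ m) = g.base ≫ toFirst X ≫ firstPartFunctor.map m := by
  rw [Functor.map_comp, firstPartFunctor_map_toQuot]
  exact Category.assoc _ _ _

theorem toQuot_comp_liftHom {M N : Str0DBiFrm.{u}} {X : IntCongSq.{u}}
    (g : kerEmbedding.obj M ⟶ X) {f : X.base ⟶ firstPartFunctor.obj N}
    (h : FrameCon.map (FrameCon.map f.hom) X.con ≤ FrameCon.ker (chi N)) {k : M ⟶ N}
    (hk : g.base ≫ f = firstPartFunctor.map k) : toQuot g ≫ liftHom f h = k :=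
  Str0DBiFrm.hom_ext <| (firstPartFunctor_map_toQuot_comp g _).trans <|
    (congrArg (g.base ≫ ·) (toFirst_liftHom f h)).trans hk

section

variable {I : Type w} [Category.{w'} I] (D : I ⥤ Str0DBiFrm.{u})

section

variable (c : Limits.Cocone (D ⋙ firstPartFunctor))

/-- The point `(L, ⋁ C² α_X (C_X))` of `∫ C²`. -/
abbrev coconePoint : IntCongSq.{u} := IntCongSq.mk c.pt (finalCon (Y := D.obj) c.ι.app)

/-- The morphism `(L_X, C_X) → (L, ⋁ C² α_X (C_X))` of `∫ C²`. -/
def coconeLeg (X : I) : kerEmbedding.obj (D.obj X) ⟶ coconePoint D c :=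
  IntCongSq.homMk (X := kerEmbedding.obj (D.obj X)) (Y := coconePoint D c) (c.ι.app X)
    (finalCon_le_iff.1 le_rfl X)

/-- The cocone of a diagram of strictly zero-dimensional biframes given by a cocone of the first
parts. -/
noncomputable def quotCocone : Limits.Cocone D where
  pt := quotFunctor.obj (coconePoint D c)
  ι :=
    { app := fun X => toQuot (coconeLeg D c X)
      naturality := fun X _ f =>
        (comp_toQuot (g := coconeLeg D c X) (c.w f)).trans (Category.comp_id _).symm }

variable {c} in
/-- `quotCocone` is a colimit if the first parts form a colimit. -/
noncomputable def quotCoconeIsColimit (hc : Limits.IsColimit c) :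
    Limits.IsColimit (quotCocone D c) :=
  have hd : ∀ s : Limits.Cocone D,
      FrameCon.map (FrameCon.map (hc.desc (firstPartFunctor.mapCocone s)).hom)
        (coconePoint D c).con ≤ FrameCon.ker (chi s.pt) := fun s => by
    refine (map_finalCon_le_iff (Y := D.obj) _).2 fun X => ?_
    have h1 : c.ι.app X ≫ hc.desc (firstPartFunctor.mapCocone s) =
        firstPartFunctor.map (s.ι.app X) := hc.fac _ X
    exact (exists_firstPartFunctor_map_iff _).1 ⟨s.ι.app X, h1.symm⟩
  { desc := fun s => liftHom (X := coconePoint D c) _ (hd s)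
    fac := fun s X => toQuot_comp_liftHom (coconeLeg D c X) (hd s)
      (hc.fac (firstPartFunctor.mapCocone s) X)
    uniq := fun s m hm => eq_liftHom (X := coconePoint D c) (hd s) <|
      hc.uniq (firstPartFunctor.mapCocone s) _ fun X =>
        (firstPartFunctor_map_toQuot_comp (coconeLeg D c X) m).symm.trans
          (congrArg firstPartFunctor.map (hm X)) }

end

section

variable (c : Limits.Cone (D ⋙ firstPartFunctor))

/-- The point `(L, ⋀ (C² β_X)_* (C_X))` of `∫ C²`. -/
abbrev conePoint : IntCongSq.{u} :=
  IntCongSq.mk c.pt (initialCon (Y := fun X => kerEmbedding.obj (D.obj X)) c.π.app)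

theorem map_conePoint_le (X : I) :
    FrameCon.map (FrameCon.map (c.π.app X).hom) (conePoint D c).con ≤
      FrameCon.ker (chi (D.obj X)) :=
  le_initialCon_iff (Y := fun X => kerEmbedding.obj (D.obj X)) (f := c.π.app).1 le_rfl X

/-- The cone over a diagram of strictly zero-dimensional biframes given by a cone over the first
parts. -/
noncomputable def quotCone : Limits.Cone D where
  pt := quotFunctor.obj (conePoint D c)
  π :=
    { app := fun X => liftHom (X := conePoint D c) (c.π.app X) (map_conePoint_le D c X)
      naturality := fun X Y f => (Category.id_comp _).trans
        (liftHom_comp (X := conePoint D c) (map_conePoint_le D c X) (map_conePoint_le D c Y)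
          (c.w f)).symm }

theorem toFirst_quotCone (X : I) :
    toFirst (conePoint D c) ≫ firstPartFunctor.map ((quotCone D c).π.app X) = c.π.app X :=
  toFirst_liftHom (X := conePoint D c) _ (map_conePoint_le D c X)

variable {c} in
/-- Since `L → (C L / C)₁` is surjective, joint injectivity of the projections passes from `L` to
the first part of `C L / C`. -/
theorem quotCone_hom_ext (hc : Limits.IsLimit c) {M : Str0DBiFrm.{u}} {f g : M ⟶ (quotCone D c).pt}
    (h : ∀ X, f ≫ (quotCone D c).π.app X = g ≫ (quotCone D c).π.app X) : f = g := by
  refine Str0DBiFrm.hom_ext (Frm.ext fun x => ?_)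
  obtain ⟨a, ha⟩ := toFirst_surjective (conePoint D c) (firstPartFunctor.map f x)
  obtain ⟨b, hb⟩ := toFirst_surjective (conePoint D c) (firstPartFunctor.map g x)
  have hab : a = b := Frm.isLimit_ext hc fun X => by
    have h1 := ConcreteCategory.congr_hom (congrArg firstPartFunctor.map (h X)) x
    rw [Functor.map_comp, Functor.map_comp] at h1
    have h2 : ∀ a, firstPartFunctor.map ((quotCone D c).π.app X) (toFirst (conePoint D c) a) =
        c.π.app X a := fun a => ConcreteCategory.congr_hom (toFirst_quotCone D c X) a
    rw [← h2, ← h2, ha, hb]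
    exact h1
  rw [← hab] at hb
  exact ha.symm.trans hb

variable {c} in
/-- `quotCone` is a limit if the first parts form a limit. -/
noncomputable def quotConeIsLimit (hc : Limits.IsLimit c) : Limits.IsLimit (quotCone D c) :=
  have hl : ∀ s : Limits.Cone D,
      FrameCon.map (FrameCon.map (hc.lift (firstPartFunctor.mapCone s)).hom)
        (kerEmbedding.obj s.pt).con ≤ (conePoint D c).con := fun s => by
    refine (map_le_initialCon_iff _).2 fun X => ?_
    have h1 : hc.lift (firstPartFunctor.mapCone s) ≫ c.π.app X =
        firstPartFunctor.map (s.π.app X) := hc.fac _ X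
    exact (exists_firstPartFunctor_map_iff _).1 ⟨s.π.app X, h1.symm⟩
  let l : ∀ s : Limits.Cone D, s.pt ⟶ quotFunctor.obj (conePoint D c) := fun s =>
    toQuot (IntCongSq.homMk (X := kerEmbedding.obj s.pt) (Y := conePoint D c)
      (hc.lift (firstPartFunctor.mapCone s)) (hl s))
  have fac : ∀ s X, l s ≫ (quotCone D c).π.app X = s.π.app X := fun s X =>
    toQuot_comp_liftHom (X := conePoint D c) _ (map_conePoint_le D c X)
      (hc.fac (firstPartFunctor.mapCone s) X)
  { lift := l
    fac := fac
    uniq := fun s m hm => quotCone_hom_ext D hc fun X => (hm X).trans (fac s X).symm }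

end

end

instance : Limits.HasLimits Str0DBiFrm.{u} :=
  ⟨fun _ _ => ⟨fun D => ⟨⟨⟨_, quotConeIsLimit D (Limits.limit.isLimit _)⟩⟩⟩⟩⟩

instance : Limits.HasColimits Str0DBiFrm.{u} :=
  ⟨fun _ _ => ⟨fun D => ⟨⟨⟨_, quotCoconeIsColimit D (Limits.colimit.isColimit _)⟩⟩⟩⟩⟩

theorem mainTheorem4 :
    -- `Str0DBiFrm` is a full reflective subcategory of `∫ C²`, consisting (up to isomorphism) of
    -- the pairs `(L, C)` with `C ≤ 𝔇_{C L}`, and `M` is recovered as `C M₁ / C` by means of `χ`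
    Nonempty (Reflective kerEmbedding.{u}) ∧
    (∀ X : IntCongSq.{u}, kerEmbedding.{u}.essImage X ↔
      X.con ≤ FrameCon.largestDense (FrameCon X.base)) ∧
    (∃ e : kerEmbedding.{u} ⋙ quotFunctor.{u} ≅ 𝟭 Str0DBiFrm.{u},
      ∀ (M : Str0DBiFrm.{u}) (θ : FrameCon (firstPartFunctor.obj M)),
        (e.hom.app M).hom.toFrameHom (quotProj (kerEmbedding.obj M) θ) = chi M θ) ∧
    -- `P` is this embedding followed by the projection `∫ C² ⥤ Frm`, which is topological
    kerEmbedding.{u} ⋙ Grothendieck.forget congSqCat.{u} = firstPartFunctor.{u} ∧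
    IsTopologicalFunctor.{w} (Grothendieck.forget congSqCat.{u}) ∧
    -- `P` is solid, and `Str0DBiFrm` is complete and cocomplete
    IsSolidFunctor.{w} firstPartFunctor.{u} ∧
    Limits.HasLimits Str0DBiFrm.{u} ∧
    Limits.HasColimits Str0DBiFrm.{u} ∧
    -- colimits
    (∀ (I : Type w) [Category.{w'} I] (D : I ⥤ Str0DBiFrm.{u})
      (c : Limits.Cocone (D ⋙ firstPartFunctor)), Nonempty (Limits.IsColimit c) →
      ∃ l : D ⟶ (Functor.const I).obj (quotFunctor.obj (IntCongSq.mk c.pt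
          (⨆ X : I, FrameCon.map (FrameCon.map (c.ι.app X).hom) (kerEmbedding.obj (D.obj X)).con))),
        (∀ (X : I) (θ : FrameCon (firstPartFunctor.obj (D.obj X))),
          (l.app X).hom.toFrameHom (chi (D.obj X) θ) =
            quotProj (IntCongSq.mk c.pt _) (FrameCon.map (c.ι.app X).hom θ)) ∧
        Nonempty (Limits.IsColimit (Limits.Cocone.mk _ l))) ∧
    -- limits
    (∀ (I : Type w) [Category.{w'} I] (D : I ⥤ Str0DBiFrm.{u})
      (c : Limits.Cone (D ⋙ firstPartFunctor)), Nonempty (Limits.IsLimit c) →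
      ∃ l : (Functor.const I).obj (quotFunctor.obj (IntCongSq.mk c.pt
          (⨅ X : I, FrameCon.comap (FrameCon.map (c.π.app X).hom)
            (kerEmbedding.obj (D.obj X)).con))) ⟶ D,
        (∀ (X : I) (θ : FrameCon c.pt),
          (l.app X).hom.toFrameHom (quotProj (IntCongSq.mk c.pt _) θ) =
            chi (D.obj X) (FrameCon.map (c.π.app X).hom θ)) ∧
        Nonempty (Limits.IsLimit (Limits.Cone.mk _ l))) := by
  refine ⟨⟨inferInstance⟩, essImage_kerEmbedding_iff,
    ⟨asIso quotAdjunction.counit, counit_quotProj⟩, rfl, isTopologicalFunctor_forget,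
    isSolidFunctor_firstPartFunctor, inferInstance, inferInstance, ?_, ?_⟩
  · rintro I _ D c ⟨hc⟩
    exact ⟨(quotCocone D c).ι, fun X θ => toQuot_chi (coconeLeg D c X) θ,
      ⟨quotCoconeIsColimit D hc⟩⟩
  · rintro I _ D c ⟨hc⟩
    exact ⟨(quotCone D c).π, fun X θ => liftHom_quotProj (X := conePoint D c) _ _ θ,
      ⟨quotConeIsLimit D hc⟩⟩
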